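/- All graphs are simple mixed graphs on one finite vertex set $V$: there are undirected ($a - b$), directed ($a\to b$) and bi-directed ($a\leftrightarrow b$) edges, at most one edge joins two vertices, and there are no loops. A path is a sequence of distinct vertices in which consecutive ones are adjacent. A vertex $a$ is an ancestor of $b$ if $a=b$ or there is a directed path $a\to\cdots\to b$. A graph is ancestral if (a) it has no directed cycle; (b) whenever $x\leftrightarrow y$, there is no directed path from $x$ to $y$ or from $y$ to $x$; (c) the ends of an undirected edge have no parents and no spouses (no edge has an arrowhead at them). A triple is a path $\langle a,b,c\rangle$ with three vertices; it is a collider if both of its edges have an arrowhead at $b$, and a noncollider otherwise. For $a\ne b$ and $a,b\notin Z$, a path between $a$ and $b$ is m-connecting given $Z\subseteq V$ if no nonendpoint that is a noncollider on it is in $Z$ and every nonendpoint that is a collider on it is an ancestor of a vertex in $Z$; $a$ and $b$ are m-separated given $Z$ if there is no such path, and sets $A,B$ are m-separated given $Z$ if all $a\in A$, $b\in B$ are. Two graphs are Markov equivalent if for all pairwise disjoint $A,B,Z\subseteq V$ with $A,B\neq\emptyset$, $A$ and $B$ are m-separated given $Z$ in one if and only if they are in the other. A maximal ancestral graph (MAG)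 is an ancestral graph in which any two distinct nonadjacent vertices $a,b$ are m-separated given some $Z$ with $a,b\notin Z$. A graph is a subgraph of another one (on the same vertices) if each of its edges is an edge of the other, with the same type and orientation. A path $\langle x,q_1,\dots,q_p,b,y\rangle$ with $p\ge 1$ is discriminating for $\langle q_p,b,y\rangle$ if $x$ and $y$ are not adjacent and every $q_i$ is a collider on the path and a parent of $y$. A triple $\langle a,b,c\rangle$ has order $0$ if $a$ and $c$ are not adjacent. It has order $i+1$ if it does not have order $j$ for any $j\le i$ and there is a discriminating path $\langle x,q_1,\dots,q_p,b,y\rangle$ with $\langle a,b,c\rangle=\langle q_p,b,y\rangle$ or $\langle a,b,c\rangle=\langle y,b,q_p\rangle$ such that each of the $p$ colliders $\langle x,q_1,q_2\rangle,\dots,\langle q_{p-1},q_p,b\rangle$ (only $\langle x,q_1,b\rangle$ if $p=1$) has some order $j\le i$. A collider with order is a collider that has order $i$ for some $i\ge 0$. **Corollary 3.28.** Let $\mathcal G_1,\mathcal G_2$ be ancestral graphs (not necessarily maximal) with the same finite vertex set. For $k=1,2$ there is a unique MAG $\bar{\mathcal G}_k$ of which $\mathcal G_k$ is a subgraph and to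 which $\mathcal G_k$ is Markov equivalent. Moreover, $\mathcal G_1$ and $\mathcal G_2$ are Markov equivalent if and only if $\bar{\mathcal G}_1$ and $\bar{\mathcal G}_2$ have the same adjacencies and the same colliders with order. -/

import Mathlib

/-- A simple mixed graph on the vertex set `V`: there are undirected edges `a — b`, directed edges
`a → b` and bi-directed edges `a ↔ b`, at most one edge between any two vertices, and no loops. -/
@[ext]
structure MixedGraph (V : Type*) where
  /-- `line a b` : there is an undirected edge `a — b`. -/
  line : V → V → Prop
  /-- `arrow a b` : there is a directed edge `a → b`. -/
  arrow : V → V → Prop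
  /-- `biarrow a b` : there is a bi-directed edge `a ↔ b`. -/
  biarrow : V → V → Prop
  line_symm : ∀ a b, line a b → line b a
  biarrow_symm : ∀ a b, biarrow a b → biarrow b a
  line_irrefl : ∀ a, ¬ line a a
  arrow_irrefl : ∀ a, ¬ arrow a a
  biarrow_irrefl : ∀ a, ¬ biarrow a a
  arrow_asymm : ∀ a b, arrow a b → ¬ arrow b a
  line_not_arrow : ∀ a b, line a b → ¬ arrow a b
  line_not_biarrow : ∀ a b, line a b → ¬ biarrow a b
  arrow_not_biarrow : ∀ a b, arrow a b → ¬ biarrow a b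

namespace MixedGraph

variable {V : Type*}

/-- Two vertices are adjacent if they are joined by some edge. -/
def Adj (G : MixedGraph V) (a b : V) : Prop :=
  G.line a b ∨ G.arrow a b ∨ G.arrow b a ∨ G.biarrow a b

/-- There is an edge between `a` and `b` with an arrowhead at `b`: `a → b` or `a ↔ b`. -/
def Into (G : MixedGraph V) (a b : V) : Prop :=
  G.arrow a b ∨ G.biarrow a b

/-- `a` is an ancestor of `b`: `a = b` or there is a directed path from `a` to `b`. (Existence of a
directed path is the same as existence of a directed walk, as repetitions can be cut out.) -/
def Ancestor (G : MixedGraph V) (a b : V) : Prop :=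
  Relation.ReflTransGen G.arrow a b

/-- A mixed graph is ancestral if (a) it has no directed cycle; (b) the ends of a bi-directed edge
are not joined by a directed path, in either direction; (c) the ends of an undirected edge have
neither parents nor spouses. -/
structure IsAncestral (G : MixedGraph V) : Prop where
  no_directed_cycle : ∀ x, ¬ Relation.TransGen G.arrow x x
  no_almost_directed_cycle : ∀ x y, G.biarrow x y →
    ¬ Relation.TransGen G.arrow x y ∧ ¬ Relation.TransGen G.arrow y x
  line_no_into : ∀ x y, G.line x y → ∀ z, ¬ G.Into z x ∧ ¬ G.Into z y

/-- The list `π` is a path between `x` and `y`: a sequence of distinct vertices, starting at `x` and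
ending at `y`, each adjacent to its successor. -/
structure IsPath (G : MixedGraph V) (x y : V) (π : List V) : Prop where
  nodup : π.Nodup
  chain : π.IsChain G.Adj
  head : π.head? = some x
  last : π.getLast? = some y

/-- `⟨a, b, c⟩` is a triple, that is, a path with three vertices. -/
def IsTriple (G : MixedGraph V) (a b c : V) : Prop :=
  G.IsPath a c [a, b, c]

/-- The triple `⟨a, b, c⟩` is a collider: both edges have an arrowhead at `b`. -/
def IsCollider (G : MixedGraph V) (a b c : V) : Prop :=
  G.IsTriple a b c ∧ G.Into a b ∧ G.Into c b

/-- The path `π` between `a` and `b` is m-connecting given `Z`: no noncollider on `π` is in `Z`, and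
every collider on `π` is an ancestor of a vertex in `Z`. The nonendpoint vertices of `π`, with their
neighbors on `π`, are given by the contiguous sublists `[u, v, w]` of `π`. -/
def MConnecting (G : MixedGraph V) (a b : V) (Z : Set V) (π : List V) : Prop :=
  G.IsPath a b π ∧ ∀ u v w, [u, v, w] <:+: π →
    (¬ G.IsCollider u v w → v ∉ Z) ∧ (G.IsCollider u v w → ∃ z ∈ Z, G.Ancestor v z)

/-- The vertices `a` and `b` are m-separated given `Z`. -/
def MSep (G : MixedGraph V) (a b : V) (Z : Set V) : Prop :=
  ¬ ∃ π, G.MConnecting a b Z π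

/-- The sets `A` and `B` are m-separated given `Z`. -/
def SetMSep (G : MixedGraph V) (A B Z : Set V) : Prop :=
  ∀ a ∈ A, ∀ b ∈ B, G.MSep a b Z

/-- Markov equivalence of graphs with the same vertex set: they have the same m-separations. -/
def MarkovEquiv (G H : MixedGraph V) : Prop :=
  ∀ A B Z : Set V, A.Nonempty → B.Nonempty → Disjoint A B → Disjoint A Z → Disjoint B Z →
    (G.SetMSep A B Z ↔ H.SetMSep A B Z)

/-- A maximal ancestral graph (MAG): an ancestral graph in which any two distinct nonadjacent
vertices are m-separated given some set that contains neither of them. -/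
structure IsMAG (G : MixedGraph V) : Prop where
  ancestral : G.IsAncestral
  maximal : ∀ a b, a ≠ b → ¬ G.Adj a b → ∃ Z : Set V, a ∉ Z ∧ b ∉ Z ∧ G.MSep a b Z

/-- `G` is a subgraph of `H` (with the same vertex set): each edge of `G` is an edge of `H`, of the
same type and orientation. -/
structure IsSubgraph (G H : MixedGraph V) : Prop where
  line : ∀ a b, G.line a b → H.line a b
  arrow : ∀ a b, G.arrow a b → H.arrow a b
  biarrow : ∀ a b, G.biarrow a b → H.biarrow a b

/-- `M` is a MAG of which `G` is a subgraph and to which `G` is Markov equivalent. -/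
structure IsMAGOf (M G : MixedGraph V) : Prop where
  isMAG : M.IsMAG
  isSubgraph : G.IsSubgraph M
  markovEquiv : G.MarkovEquiv M

/-- `⟨x, q₁, …, qₚ, b, y⟩`, `p ≥ 1`, is a discriminating path for `⟨qₚ, b, y⟩`, where
`qs = [q₁, …, qₚ₋₁]` and `q = qₚ`: it is a path, `x` is not adjacent to `y`, and each `qᵢ` is a
collider on the path and a parent of `y`. The contiguous sublists of length three of
`⟨x, q₁, …, qₚ, b⟩` are the triples `⟨x, q₁, q₂⟩, …, ⟨qₚ₋₁, qₚ, b⟩` (just `⟨x, q₁, b⟩` if `p = 1`). -/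
structure IsDiscriminating (G : MixedGraph V) (x : V) (qs : List V) (q b y : V) : Prop where
  isPath : G.IsPath x y (x :: (qs ++ [q, b, y]))
  not_adj : ¬ G.Adj x y
  collider : ∀ u v w, [u, v, w] <:+: x :: (qs ++ [q, b]) → G.IsCollider u v w
  parent : ∀ v ∈ qs ++ [q], G.arrow v y

/-- `G.HasOrderEq i a b c` : the triple `⟨a, b, c⟩` has order `i` in `G`. -/
def HasOrderEq (G : MixedGraph V) : ℕ → V → V → V → Prop
  | 0, a, b, c => G.IsTriple a b c ∧ ¬ G.Adj a c
  | i + 1, a, b, c =>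
    (∀ j, ∀ _ : j < i + 1, ¬ G.HasOrderEq j a b c) ∧
    ∃ (x : V) (qs : List V) (q y : V),
      ((a = q ∧ c = y) ∨ (a = y ∧ c = q)) ∧
      G.IsDiscriminating x qs q b y ∧
      ∀ u v w, [u, v, w] <:+: x :: (qs ++ [q, b]) → ∃ j, ∃ _ : j ≤ i, G.HasOrderEq j u v w
  termination_by i => i

/-- The triple `⟨a, b, c⟩` is a collider with order. -/
def IsColliderWithOrder (G : MixedGraph V) (a b c : V) : Prop :=
  G.IsCollider a b c ∧ ∃ i, G.HasOrderEq i a b c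

/-- The two graphs have the same adjacencies. -/
def SameAdjacencies (G H : MixedGraph V) : Prop :=
  ∀ a b, G.Adj a b ↔ H.Adj a b

/-- The two graphs have the same colliders with order. -/
def SameCollidersWithOrder (G H : MixedGraph V) : Prop :=
  ∀ a b c, G.IsColliderWithOrder a b c ↔ H.IsColliderWithOrder a b c

end MixedGraph

/-!
**The maximal ancestral graph.** Two nonadjacent vertices `a`, `b` of an ancestral graph `G` that no
set separates are joined by an inducing path: all its inner vertices are colliders and ancestors of
`a` or `b` (`Inseparable.exists_isInducing`). Joining each such pair by an edge, with marks given by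
the ancestor relation, gives `completion`, which has the same ancestors as `G`. A walk of the
completion becomes one of `G` when the new edges are replaced by inducing paths. Its colliders are
ancestors of `Z` or of its ends, and this implies m-connection (`Conn.of_isWalk`). Conversely, in a
maximal ancestral graph of `G` the inseparable pairs are adjacent, and the inducing paths force the
marks of their edges (`IsMAGOf.eq_completion`).

**Equivalent graphs have the same colliders with order.** A set that separates the ends of a
discriminating path contains all its inner colliders before the discriminated vertex, and contains
the latter exactly if it is a noncollider (`IsDisc.coll_iff`). So equivalent graphs agree on which triples have
an order, and on which of these are colliders (`IsMAG.ordered_of_markovEquiv`).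

**The colliders with order determine the m-connections.** Consider a shortest m-connecting walk in a
maximal ancestral graph. If a triple of it is shielded, then the shortcut must fail at one side, and
going on from there along the walk one meets a discriminating path for the triple. It follows, by
maximality, that every triple of the walk has an order (`IsShortestWalk.ordered`), and so has the same
status in the other graph. It remains to see that its colliders are ancestors of `Z` there. Let
`c → y` be the first edge of a shortest directed path from a collider `c` to `Z`. If `c → y` is an
edge of the other graph, then so are all edges of the directed path, which is unshielded. Otherwise `c`
could be replaced by `y`, which gives a walk that is shorter, or just as long with smaller distances
to `Z` (`Conn.of_sameCollidersWithOrder`).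

Walks are functions `ℕ → V` together with a length.
-/

namespace MixedGraph

variable {V : Type*} {G : MixedGraph V} {a b c x y z : V}

/-! ### Arrowheads in ancestral graphs -/

theorem Adj.symm (h : G.Adj a b) : G.Adj b a := by
  rcases h with h | h | h | h
  · exact Or.inl (G.line_symm _ _ h)
  · exact Or.inr (Or.inr (Or.inl h))
  · exact Or.inr (Or.inl h)
  · exact Or.inr (Or.inr (Or.inr (G.biarrow_symm _ _ h)))

theorem Into.adj (h : G.Into a b) : G.Adj a b := by
  rcases h with h | h
  · exact Or.inr (Or.inl h)
  · exact Or.inr (Or.inr (Or.inr h))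

theorem not_adj_self (a : V) : ¬ G.Adj a a := by
  rintro (h | h | h | h)
  · exact G.line_irrefl _ h
  · exact G.arrow_irrefl _ h
  · exact G.arrow_irrefl _ h
  · exact G.biarrow_irrefl _ h

theorem Adj.ne (h : G.Adj a b) : a ≠ b := by
  rintro rfl
  exact not_adj_self _ h

theorem not_into_of_arrow (h : G.arrow a b) : ¬ G.Into b a := by
  rintro (h' | h')
  · exact G.arrow_asymm _ _ h h'
  · exact G.arrow_not_biarrow _ _ h (G.biarrow_symm _ _ h')

namespace IsAncestral

variable (hG : G.IsAncestral)
include hG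

theorem not_into_of_transGen (h : Relation.TransGen G.arrow a b) : ¬ G.Into b a := by
  rintro (h' | h')
  · exact hG.no_directed_cycle a (h.tail h')
  · exact (hG.no_almost_directed_cycle _ _ h').2 h

theorem not_line_of_into (h : G.Into z a) (b : V) : ¬ G.line a b :=
  fun hl => (hG.line_no_into _ _ hl z).1 h

theorem arrow_of_not_into (hadj : G.Adj a b) (hn : ¬ G.Into b a) (hz : G.Into z a) :
    G.arrow a b := by
  rcases hadj with h | h | h | h
  · exact absurd h (hG.not_line_of_into hz b)
  · exact h
  · exact absurd (Or.inl h) hn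
  · exact absurd (Or.inr (G.biarrow_symm _ _ h)) hn

theorem arrow_of_transGen (h : Relation.TransGen G.arrow a b) (hadj : G.Adj a b) :
    G.arrow a b := by
  obtain ⟨z, -, hz⟩ := Relation.TransGen.tail'_iff.1 h
  rcases hadj with h' | h' | h' | h'
  · exact absurd (Or.inl hz) (hG.line_no_into _ _ h' z).2
  · exact h'
  · exact absurd (Or.inl h') (hG.not_into_of_transGen h)
  · exact absurd h (hG.no_almost_directed_cycle _ _ h').1

theorem arrow_trans (h : G.arrow a b) (h' : G.arrow b c) (hadj : G.Adj a c) : G.arrow a c :=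
  hG.arrow_of_transGen ((Relation.TransGen.single h).tail h') hadj

/-- An arrowhead at `b` is carried along a directed edge `b → c`, as otherwise an (almost) directed
cycle would arise. -/
theorem into_of_into_arrow (h : G.Into a b) (h' : G.arrow b c) (hadj : G.Adj a c) :
    G.Into a c := by
  by_contra hn
  have hca : G.arrow c a := hG.arrow_of_not_into hadj.symm hn (Or.inl h')
  exact hG.not_into_of_transGen ((Relation.TransGen.single h').tail hca) h

end IsAncestral

theorem Ancestor.eq_or_transGen (h : G.Ancestor a b) : a = b ∨ Relation.TransGen G.arrow a b := by
  rcases Relation.reflTransGen_iff_eq_or_transGen.1 h with h | h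
  · exact Or.inl h.symm
  · exact Or.inr h

/-! ### Unblocked walks -/

/-- `v` is a collider between the neighbors `u` and `w` on a walk, where `u = w` is allowed. -/
def Coll (G : MixedGraph V) (u v w : V) : Prop :=
  G.Into u v ∧ G.Into w v

theorem Coll.symm {u v w : V} (h : G.Coll u v w) : G.Coll w v u := And.symm h

theorem coll_comm {u v w : V} : G.Coll u v w ↔ G.Coll w v u := And.comm

/-- A walk with the consecutive vertices `u, v, w` is not blocked at `v`: colliders satisfy `C`, and
noncolliders are outside `Z`. For m-connection, `C` holds for the ancestors of `Z`. -/
def Open (G : MixedGraph V) (C : V → Prop) (Z : Set V) (u v w : V) : Prop :=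
  (G.Coll u v w → C v) ∧ (¬ G.Coll u v w → v ∉ Z)

theorem Open.symm {C : V → Prop} {Z : Set V} {u v w : V} (h : G.Open C Z u v w) :
    G.Open C Z w v u :=
  ⟨fun h' => h.1 h'.symm, fun h' => h.2 fun h'' => h' h''.symm⟩

theorem Open.mono {C C' : V → Prop} {Z : Set V} {u v w : V} (h : G.Open C Z u v w)
    (hC : C v → C' v) : G.Open C' Z u v w :=
  ⟨fun h' => hC (h.1 h'), h.2⟩

/-- `v 0, …, v n` is a walk of length `n` from `x` to `y` that is not blocked at any of its inner
vertices. The values of `v` beyond `n` are irrelevant. -/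
structure IsWalk (G : MixedGraph V) (C : V → Prop) (Z : Set V) (n : ℕ) (v : ℕ → V) (x y : V) :
    Prop where
  head : v 0 = x
  last : v n = y
  adj : ∀ i < n, G.Adj (v i) (v (i + 1))
  isOpen : ∀ i, i + 1 < n → G.Open C Z (v i) (v (i + 1)) (v (i + 2))

namespace IsWalk

variable {C C' : V → Prop} {Z : Set V} {n m : ℕ} {v p q : ℕ → V} {s : V}

theorem refl (C : V → Prop) (Z : Set V) (x : V) : G.IsWalk C Z 0 (fun _ => x) x x :=
  ⟨rfl, rfl, fun i hi => absurd hi (by omega), fun i hi => absurd hi (by omega)⟩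

theorem edge (C : V → Prop) (Z : Set V) (h : G.Adj x y) :
    G.IsWalk C Z 1 (fun i => if i = 0 then x else y) x y where
  head := rfl
  last := rfl
  adj i hi := by
    obtain rfl : i = 0 := by omega
    simpa using h
  isOpen i hi := by omega

theorem mono (h : G.IsWalk C Z n v x y) (hC : ∀ i, 0 < i → i < n → C (v i) → C' (v i)) :
    G.IsWalk C' Z n v x y :=
  ⟨h.head, h.last, h.adj, fun i hi => (h.isOpen i hi).mono (hC _ (by omega) hi)⟩

theorem take (h : G.IsWalk C Z n v x y) (hm : m ≤ n) : G.IsWalk C Z m v x (v m) :=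
  ⟨h.head, rfl, fun i hi => h.adj i (by omega), fun i hi => h.isOpen i (by omega)⟩

theorem drop (h : G.IsWalk C Z n v x y) (hm : m ≤ n) :
    G.IsWalk C Z (n - m) (fun i => v (m + i)) (v m) y where
  head := rfl
  last := by
    have : m + (n - m) = n := by omega
    simpa only [this] using h.last
  adj i hi := h.adj (m + i) (by omega)
  isOpen i hi := h.isOpen (m + i) (by omega)

theorem reverse (h : G.IsWalk C Z n v x y) : G.IsWalk C Z n (fun i => v (n - i)) y x where
  head := h.last
  last := by simpa using h.head
  adj i hi := by
    have := (h.adj (n - (i + 1)) (by omega)).symm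
    rwa [show n - (i + 1) + 1 = n - i by omega] at this
  isOpen i hi := by
    have := (h.isOpen (n - (i + 2)) (by omega)).symm
    rwa [show n - (i + 2) + 2 = n - i by omega, show n - (i + 2) + 1 = n - (i + 1) by omega] at this

theorem append (h₁ : G.IsWalk C Z m p x s) (h₂ : G.IsWalk C Z n q s y)
    (hs : 0 < m → 0 < n → G.Open C Z (p (m - 1)) s (q 1)) :
    G.IsWalk C Z (m + n) (fun i => if i ≤ m then p i else q (i - m)) x y where
  head := by simpa using h₁.head
  last := by
    rcases Nat.eq_zero_or_pos n with rfl | hn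
    · simpa using h₁.last.trans (h₂.head.symm.trans h₂.last)
    · simpa [show ¬ m + n ≤ m by omega] using h₂.last
  adj i hi := by
    rcases lt_trichotomy i m with h | rfl | h
    · simpa [show i ≤ m by omega, show i + 1 ≤ m by omega] using h₁.adj i h
    · simpa [h₁.last, ← h₂.head] using h₂.adj 0 (by omega)
    · simpa [show ¬ i ≤ m by omega, show ¬ i + 1 ≤ m by omega, show i + 1 - m = i - m + 1 by omega]
        using h₂.adj (i - m) (by omega)
  isOpen i hi := by
    rcases lt_trichotomy (i + 1) m with h | rfl | h
    · simpa [show i ≤ m by omega, show i + 1 ≤ m by omega, show i + 2 ≤ m by omega]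
        using h₁.isOpen i h
    · simpa [h₁.last, show i + 2 - (i + 1) = 1 by omega] using hs (by omega) (by omega)
    · rcases Nat.eq_or_lt_of_le (show m ≤ i by omega) with rfl | h'
      · simpa [h₁.last, ← h₂.head] using h₂.isOpen 0 (by omega)
      · simpa [show ¬ i ≤ m by omega, show ¬ i + 1 ≤ m by omega, show ¬ i + 2 ≤ m by omega,
          show i + 1 - m = i - m + 1 by omega, show i + 2 - m = i - m + 2 by omega]
          using h₂.isOpen (i - m) (by omega)

/-- Following a walk along a directed edge, the walk stays directed until it meets a collider. -/
theorem run (hG : G.IsAncestral) (h : G.IsWalk C Z n v x y) {i : ℕ} (hi : G.arrow (v i) (v (i + 1)))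
    (j : ℕ) (hij : i + (j + 1) ≤ n) :
    (∃ u, C u ∧ G.Ancestor (v i) u) ∨
      (G.Ancestor (v i) (v (i + (j + 1))) ∧ G.arrow (v (i + j)) (v (i + (j + 1)))) := by
  induction j with
  | zero => exact Or.inr ⟨Relation.ReflTransGen.single hi, hi⟩
  | succ j ih =>
    rcases ih (by omega) with h' | ⟨h₁, h₂⟩
    · exact Or.inl h'
    · by_cases hc : G.Coll (v (i + j)) (v (i + (j + 1))) (v (i + (j + 1) + 1))
      · exact Or.inl ⟨_, (h.isOpen (i + j) (by omega)).1 hc, h₁⟩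
      · have harr : G.arrow (v (i + (j + 1))) (v (i + (j + 1) + 1)) :=
          hG.arrow_of_not_into (h.adj _ (by omega)) (fun h' => hc ⟨Or.inl h₂, h'⟩) (Or.inl h₂)
        exact Or.inr ⟨h₁.tail harr, harr⟩

theorem ancestor_of_arrow (hG : G.IsAncestral) (h : G.IsWalk C Z n v x y) {i : ℕ} (hi : i < n)
    (harr : G.arrow (v i) (v (i + 1))) :
    (∃ u, C u ∧ G.Ancestor (v i) u) ∨ G.Ancestor (v i) y := by
  have := h.run hG harr (n - i - 1) (by omega)
  rw [show i + (n - i - 1 + 1) = n by omega, h.last] at this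
  exact this.imp_right And.left

/-- A loop can be cut out of a walk. If this makes a collider of a vertex at which there was none,
then the loop leaves and enters that vertex by tails, so that the loop contains a collider that
descends from it. -/
theorem exists_shorter (hG : G.IsAncestral) (hC : ∀ u w, G.Ancestor u w → C w → C u)
    (h : G.IsWalk C Z n v x y) {i j : ℕ} (hij : i < j) (hj : j ≤ n) (hv : v i = v j) :
    ∃ m < n, ∃ w, G.IsWalk C Z m w x y := by
  have h₂ := h.drop hj
  rw [← hv] at h₂
  refine ⟨i + (n - j), by omega, _, (h.take (by omega : i ≤ n)).append h₂ fun hi hn => ?_⟩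
  have o₁ := h.isOpen (i - 1) (by omega)
  have o₂ := h.isOpen (j - 1) (by omega)
  rw [show i - 1 + 1 = i by omega, show i - 1 + 2 = i + 1 by omega] at o₁
  rw [show j - 1 + 1 = j by omega, show j - 1 + 2 = j + 1 by omega, ← hv] at o₂
  refine ⟨fun hc => ?_, fun hc => ?_⟩
  · by_cases c₁ : G.Coll (v (i - 1)) (v i) (v (i + 1))
    · exact o₁.1 c₁
    by_cases c₂ : G.Coll (v (j - 1)) (v i) (v (j + 1))
    · exact o₂.1 c₂
    have a₁ : G.arrow (v i) (v (i + 1)) :=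
      hG.arrow_of_not_into (h.adj i (by omega)) (fun h' => c₁ ⟨hc.1, h'⟩) hc.1
    rcases h.run hG a₁ (j - i - 1) (by omega) with ⟨u, hu, hvu⟩ | ⟨-, h'⟩
    · exact hC _ _ hvu hu
    · rw [show i + (j - i - 1 + 1) = j by omega, show i + (j - i - 1) = j - 1 by omega, ← hv] at h'
      exact absurd ⟨Or.inl h', hc.2⟩ c₂
  · by_cases c₁ : G.Into (v (i - 1)) (v i)
    · exact o₂.2 fun h' => hc ⟨c₁, h'.2⟩
    · exact o₁.2 fun h' => c₁ h'.1

end IsWalk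

/-! ### Shortest m-connecting walks -/

/-- `u` is an ancestor of a vertex in `Z`. -/
def AncOf (G : MixedGraph V) (Z : Set V) (u : V) : Prop :=
  ∃ z ∈ Z, G.Ancestor u z

theorem AncOf.of_ancestor {Z : Set V} {u w : V} (h : G.Ancestor u w) (hw : G.AncOf Z w) :
    G.AncOf Z u := by
  obtain ⟨z, hz, hwz⟩ := hw
  exact ⟨z, hz, Relation.ReflTransGen.trans h hwz⟩

/-- There is an m-connecting walk between `x` and `y` given `Z`. -/
def Conn (G : MixedGraph V) (Z : Set V) (x y : V) : Prop :=
  ∃ n v, G.IsWalk (G.AncOf Z) Z n v x y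

/-- `v` is an m-connecting walk of minimal length between `x` and `y` given `Z`. -/
structure IsShortestWalk (G : MixedGraph V) (Z : Set V) (n : ℕ) (v : ℕ → V) (x y : V) : Prop where
  isWalk : G.IsWalk (G.AncOf Z) Z n v x y
  le : ∀ m w, G.IsWalk (G.AncOf Z) Z m w x y → n ≤ m

theorem IsShortestWalk.injective (hG : G.IsAncestral) {Z : Set V} {n : ℕ} {v : ℕ → V}
    (h : G.IsShortestWalk Z n v x y) {i j : ℕ} (hi : i ≤ n) (hj : j ≤ n) (hv : v i = v j) :
    i = j := by
  by_contra hij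
  wlog hlt : i < j generalizing i j
  · exact this hj hi hv.symm (Ne.symm hij) (by omega)
  obtain ⟨m, hm, w, hw⟩ :=
    h.isWalk.exists_shorter hG (fun _ _ => AncOf.of_ancestor) hlt hj hv
  have := h.le m w hw
  omega

theorem Conn.exists_isShortestWalk {Z : Set V} (h : G.Conn Z x y) :
    ∃ n v, G.IsShortestWalk Z n v x y := by
  classical
  refine ⟨Nat.find h, ?_⟩
  obtain ⟨v, hv⟩ := Nat.find_spec h
  exact ⟨v, hv, fun m w hw => Nat.find_min' h ⟨w, hw⟩⟩

/-! ### Paths as lists and m-separation -/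

theorem exists_eq_map_range {α : Type*} (l : List α) (d : α) :
    l = (List.range l.length).map fun i => l.getD i d := by
  apply List.ext_getElem
  · simp
  · intro i h₁ h₂
    simp [h₁]

theorem triple_infix_map_range {α : Type*} {v : ℕ → α} {n : ℕ} {a b c : α} :
    [a, b, c] <:+: (List.range n).map v ↔
      ∃ i, i + 2 < n ∧ a = v i ∧ b = v (i + 1) ∧ c = v (i + 2) := by
  constructor
  · rintro ⟨s, t, h⟩
    have hlen := congrArg List.length h
    simp only [List.length_append, List.length_cons, List.length_nil, List.length_map,
      List.length_range] at hlen
    have key : ∀ k, k < 3 → ((List.range n).map v)[s.length + k]? = [a, b, c][k]? := by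
      intro k hk
      rw [← h, List.append_assoc, List.getElem?_append_right (by omega)]
      rw [List.getElem?_append_left (by simp; omega)]
      simp
    refine ⟨s.length, by omega, ?_, ?_, ?_⟩
    · simpa [show s.length < n by omega] using (key 0 (by omega)).symm
    · simpa [show s.length + 1 < n by omega] using (key 1 (by omega)).symm
    · simpa [show s.length + 2 < n by omega] using (key 2 (by omega)).symm
  · rintro ⟨i, hi, rfl, rfl, rfl⟩
    refine ⟨((List.range n).map v).take i, ((List.range n).map v).drop (i + 3), ?_⟩
    have hdrop : ((List.range n).map v).drop i =
        [v i, v (i + 1), v (i + 2)] ++ ((List.range n).map v).drop (i + 3) := by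
      rw [List.drop_eq_getElem_cons (i := i) (by simp; omega),
        List.drop_eq_getElem_cons (i := i + 1) (by simp; omega),
        List.drop_eq_getElem_cons (i := i + 1 + 1) (by simp; omega)]
      simp
    rw [List.append_assoc, ← hdrop, List.take_append_drop]

theorem isPath_map_range {v : ℕ → V} {n : ℕ} :
    G.IsPath x y ((List.range (n + 1)).map v) ↔
      v 0 = x ∧ v n = y ∧ (∀ i < n, G.Adj (v i) (v (i + 1))) ∧
        ∀ i j, i ≤ n → j ≤ n → v i = v j → i = j := by
  have hnodup : ((List.range (n + 1)).map v).Nodup ↔ ∀ i j, i ≤ n → j ≤ n → v i = v j → i = j := by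
    rw [List.nodup_map_iff_inj_on List.nodup_range]
    simp only [List.mem_range, Nat.lt_succ_iff]
    exact ⟨fun h i j hi hj => h i hi j hj, fun h i hi j hj => h i j hi hj⟩
  have hchain : ((List.range (n + 1)).map v).IsChain G.Adj ↔ ∀ i < n, G.Adj (v i) (v (i + 1)) := by
    rw [List.isChain_iff_getElem]
    simp
  have hhead : ((List.range (n + 1)).map v).head? = some (v 0) := by
    simp [List.range_succ_eq_map]
  have hlast : ((List.range (n + 1)).map v).getLast? = some (v n) := by
    simp [List.range_succ]
  constructor
  · rintro ⟨h₁, h₂, h₃, h₄⟩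
    rw [hhead] at h₃
    rw [hlast] at h₄
    exact ⟨Option.some.inj h₃, Option.some.inj h₄, hchain.1 h₂, hnodup.1 h₁⟩
  · rintro ⟨h₃, h₄, h₂, h₁⟩
    exact ⟨hnodup.2 h₁, hchain.2 h₂, by rw [hhead, h₃], by rw [hlast, h₄]⟩

theorem isTriple_iff : G.IsTriple a b c ↔ a ≠ c ∧ G.Adj a b ∧ G.Adj b c := by
  constructor
  · rintro ⟨h₁, h₂, -, -⟩
    simp at h₁ h₂
    exact ⟨h₁.1.2, h₂⟩
  · rintro ⟨h₁, h₂, h₃⟩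
    refine ⟨?_, ?_, rfl, rfl⟩
    · simp [h₁, h₂.ne, h₃.ne]
    · simp [h₂, h₃]

theorem isCollider_iff : G.IsCollider a b c ↔ a ≠ c ∧ G.Coll a b c := by
  rw [IsCollider, isTriple_iff]
  exact ⟨fun h => ⟨h.1.1, h.2⟩, fun h => ⟨⟨h.1, h.2.1.adj, h.2.2.adj.symm⟩, h.2⟩⟩

theorem mConnecting_map_range {Z : Set V} {v : ℕ → V} {n : ℕ} :
    G.MConnecting x y Z ((List.range (n + 1)).map v) ↔
      G.IsWalk (G.AncOf Z) Z n v x y ∧ ∀ i j, i ≤ n → j ≤ n → v i = v j → i = j := by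
  rw [MConnecting, isPath_map_range]
  constructor
  · rintro ⟨⟨h₁, h₂, h₃, h₄⟩, h₅⟩
    refine ⟨⟨h₁, h₂, h₃, fun i hi => ?_⟩, h₄⟩
    have hne : v i ≠ v (i + 2) := fun h => by
      have := h₄ _ _ (by omega) (by omega) h
      omega
    have := h₅ _ _ _ (triple_infix_map_range.2 ⟨i, by omega, rfl, rfl, rfl⟩)
    simp only [isCollider_iff, hne, ne_eq, not_false_eq_true, true_and] at this
    exact ⟨this.2, this.1⟩
  · rintro ⟨h, h₄⟩
    refine ⟨⟨h.head, h.last, h.adj, h₄⟩, fun u w t hi => ?_⟩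
    obtain ⟨i, hi, rfl, rfl, rfl⟩ := triple_infix_map_range.1 hi
    have hne : v i ≠ v (i + 2) := fun h => by
      have := h₄ _ _ (by omega) (by omega) h
      omega
    simp only [isCollider_iff, hne, ne_eq, not_false_eq_true, true_and]
    exact ⟨(h.isOpen i (by omega)).2, (h.isOpen i (by omega)).1⟩

theorem MConnecting.exists_isWalk {Z : Set V} {π : List V} (h : G.MConnecting x y Z π) :
    ∃ n v, G.IsWalk (G.AncOf Z) Z n v x y ∧ ∀ i j, i ≤ n → j ≤ n → v i = v j → i = j := by
  obtain ⟨n, hn⟩ : ∃ n, π.length = n + 1 := by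
    cases π with
    | nil => simpa using h.1.head
    | cons a l => exact ⟨l.length, rfl⟩
  rw [exists_eq_map_range π x, hn] at h
  exact ⟨n, _, mConnecting_map_range.1 h⟩

/-- Paths may be replaced by walks in the definition of m-separation. -/
theorem IsAncestral.mSep_iff (hG : G.IsAncestral) {Z : Set V} :
    G.MSep x y Z ↔ ¬ G.Conn Z x y := by
  rw [MSep, not_iff_not]
  constructor
  · rintro ⟨π, h⟩
    obtain ⟨n, v, hv, -⟩ := h.exists_isWalk
    exact ⟨n, v, hv⟩
  · intro h
    obtain ⟨n, v, hv⟩ := h.exists_isShortestWalk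
    exact ⟨_, mConnecting_map_range.2 ⟨hv.isWalk, fun i j hi hj => hv.injective hG hi hj⟩⟩

theorem markovEquiv_iff {H : MixedGraph V} (hG : G.IsAncestral) (hH : H.IsAncestral) :
    G.MarkovEquiv H ↔
      ∀ a b Z, a ≠ b → a ∉ Z → b ∉ Z → (G.Conn Z a b ↔ H.Conn Z a b) := by
  constructor
  · intro h a b Z hab ha hb
    have := h {a} {b} Z (by simp) (by simp) (by simpa using hab) (by simpa using ha)
      (by simpa using hb)
    simpa [SetMSep, hG.mSep_iff, hH.mSep_iff, not_iff_not] using this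
  · intro h A B Z _ _ hAB hAZ hBZ
    refine forall₂_congr fun a ha => forall₂_congr fun b hb => ?_
    rw [hG.mSep_iff, hH.mSep_iff, h a b Z]
    · rintro rfl
      exact Set.disjoint_left.1 hAB ha hb
    · exact Set.disjoint_left.1 hAZ ha
    · exact Set.disjoint_left.1 hBZ hb

/-! ### Relaxed walks and inducing walks -/

/-- A directed path that leaves a vertex which is not an ancestor of `Z` avoids `Z`. -/
theorem exists_isWalk_of_ancestor (C : V → Prop) {Z : Set V} {u : V} (h : G.Ancestor u x)
    (hu : ¬ G.AncOf Z u) :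
    ∃ n v, G.IsWalk C Z n v u x ∧ (∀ i < n, G.arrow (v i) (v (i + 1))) := by
  induction h using Relation.ReflTransGen.head_induction_on with
  | refl => exact ⟨0, _, IsWalk.refl C Z x, fun i hi => absurd hi (by omega)⟩
  | @head u w h' _ ih =>
    have hw : ¬ G.AncOf Z w := fun h'' => hu (h''.of_ancestor (Relation.ReflTransGen.single h'))
    obtain ⟨n, v, hv, harr⟩ := ih hw
    refine ⟨1 + n, _, (IsWalk.edge C Z (Or.inr (Or.inl h'))).append hv fun _ hn => ?_, ?_⟩
    · have := harr 0 hn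
      rw [hv.head] at this
      exact ⟨fun hc => absurd hc.2 (not_into_of_arrow this),
        fun _ hwZ => hw ⟨w, hwZ, Relation.ReflTransGen.refl⟩⟩
    · intro i hi
      rcases Nat.eq_zero_or_pos i with rfl | hi'
      · simpa using h'
      · rcases Nat.eq_or_lt_of_le (show 1 ≤ i by omega) with rfl | h''
        · simpa [← hv.head] using harr 0 (by omega)
        · have := harr (i - 1) (by omega)
          simpa [show ¬ i ≤ 1 by omega, show i ≠ 0 by omega, show i - 1 + 1 = i by omega] using this

/-- Colliders that are ancestors of the first vertex may be removed: the part of the walk up to the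
last one of them that is not an ancestor of `Z` is replaced by a directed path, which avoids `Z`. -/
theorem IsWalk.relax {P : V → Prop} {Z : Set V} {n : ℕ} {v : ℕ → V}
    (h : G.IsWalk (fun u => (G.AncOf Z u ∨ P u) ∨ G.Ancestor u x) Z n v x y) :
    ∃ m w, G.IsWalk (fun u => G.AncOf Z u ∨ P u) Z m w x y := by
  classical
  by_cases hbad : ∃ k, k < n ∧ ¬ G.AncOf Z (v (n - k)) ∧ G.Ancestor (v (n - k)) x
  · -- `n - k` is the last position of a vertex that is an ancestor of `x` but not of `Z`.
    obtain ⟨hk, hZ, hx⟩ := Nat.find_spec hbad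
    set k := Nat.find hbad with hkdef
    have hmin : ∀ l < k, ¬ (l < n ∧ ¬ G.AncOf Z (v (n - l)) ∧ G.Ancestor (v (n - l)) x) :=
      fun l hl => Nat.find_min hbad hl
    obtain ⟨m, w, hw, harr⟩ :=
      exists_isWalk_of_ancestor (fun u => G.AncOf Z u ∨ P u) hx hZ
    have hs : G.IsWalk (fun u => G.AncOf Z u ∨ P u) Z (n - (n - k)) (fun i => v (n - k + i))
        (v (n - k)) y := by
      refine (h.drop (by omega)).mono fun i hi hi' hC => hC.elim id fun hanc => ?_
      by_contra hno
      refine hmin (k - i) (by omega) ⟨by omega, ?_⟩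
      rw [show n - (k - i) = n - k + i by omega]
      exact ⟨fun h' => hno (Or.inl h'), hanc⟩
    refine ⟨_, _, hw.reverse.append hs fun hm _ => ?_⟩
    have := harr 0 hm
    rw [hw.head] at this
    rw [show m - (m - 1) = 1 by omega]
    exact ⟨fun hc => absurd hc.1 (not_into_of_arrow this),
      fun _ h' => hZ ⟨_, h', Relation.ReflTransGen.refl⟩⟩
  · push Not at hbad
    refine ⟨n, v, h.mono fun i hi hi' hC => hC.elim id fun hanc => ?_⟩
    by_contra hno
    have := hbad (n - i) (by omega)
    rw [show n - (n - i) = i by omega] at this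
    exact this (fun h' => hno (Or.inl h')) hanc

/-- Colliders that are ancestors of the ends of the walk do no harm. -/
theorem Conn.of_isWalk {Z : Set V} {n : ℕ} {v : ℕ → V}
    (h : G.IsWalk (fun u => G.AncOf Z u ∨ G.Ancestor u x ∨ G.Ancestor u y) Z n v x y) :
    G.Conn Z x y := by
  have h₁ : G.IsWalk (fun u => (G.AncOf Z u ∨ G.Ancestor u y) ∨ G.Ancestor u x) Z n v x y :=
    h.mono fun i _ _ => by tauto
  obtain ⟨m, w, hw⟩ := h₁.relax
  have h₂ : G.IsWalk (fun u => (G.AncOf Z u ∨ False) ∨ G.Ancestor u y) Z m _ y x :=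
    hw.reverse.mono fun i _ _ => by tauto
  obtain ⟨l, t, ht⟩ := h₂.relax
  exact ⟨l, _, ht.reverse.mono fun i _ _ => by tauto⟩

theorem Conn.symm {Z : Set V} (h : G.Conn Z x y) : G.Conn Z y x := by
  obtain ⟨n, v, hv⟩ := h
  exact ⟨n, _, hv.reverse⟩

theorem Adj.conn (h : G.Adj x y) (Z : Set V) : G.Conn Z x y := ⟨1, _, IsWalk.edge _ Z h⟩

/-- The ends of an inducing walk in a maximal ancestral graph are adjacent. -/
theorem IsMAG.adj_of_inducing (hG : G.IsMAG) {n : ℕ} {v : ℕ → V} (hne : v 0 ≠ v n)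
    (hadj : ∀ i < n, G.Adj (v i) (v (i + 1)))
    (hcoll : ∀ i, i + 1 < n → G.Coll (v i) (v (i + 1)) (v (i + 2)))
    (hanc : ∀ i, i + 1 < n → G.Ancestor (v (i + 1)) (v 0) ∨ G.Ancestor (v (i + 1)) (v n)) :
    G.Adj (v 0) (v n) := by
  by_contra hno
  obtain ⟨Z, -, -, hZ⟩ := hG.maximal _ _ hne hno
  refine hG.ancestral.mSep_iff.1 hZ (Conn.of_isWalk (n := n) (v := v) ⟨rfl, rfl, hadj, fun i hi => ?_⟩)
  exact ⟨fun _ => Or.inr (hanc i hi), fun h => absurd (hcoll i hi) h⟩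

theorem IsMAG.adj_iff (hG : G.IsMAG) (hne : a ≠ b) :
    G.Adj a b ↔ ∀ Z, a ∉ Z → b ∉ Z → G.Conn Z a b := by
  refine ⟨fun h Z _ _ => h.conn Z, fun h => ?_⟩
  by_contra hno
  obtain ⟨Z, ha, hb, hZ⟩ := hG.maximal _ _ hne hno
  exact hG.ancestral.mSep_iff.1 hZ (h Z ha hb)

theorem IsAncestral.eq_of_ancestor (hG : G.IsAncestral) (h : G.Ancestor a b)
    (h' : G.Ancestor b a) : a = b := by
  rcases h.eq_or_transGen with h | h
  · exact h
  · exact absurd (Relation.TransGen.trans_left h h') (hG.no_directed_cycle a)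

theorem IsAncestral.eq_of_ancestor_of_line (hG : G.IsAncestral) (h : G.Ancestor a b)
    (hl : G.line b c) : a = b := by
  rcases h.eq_or_transGen with h | h
  · exact h
  · obtain ⟨z, -, hz⟩ := Relation.TransGen.tail'_iff.1 h
    exact absurd hl (hG.not_line_of_into (Or.inl hz) c)

theorem IsWalk.ancestor_head_of_arrow {C : V → Prop} {Z : Set V} {n : ℕ} {v : ℕ → V}
    (hG : G.IsAncestral) (h : G.IsWalk C Z n v x y) {i : ℕ} (hi : i < n)
    (harr : G.arrow (v (i + 1)) (v i)) :
    (∃ u, C u ∧ G.Ancestor (v (i + 1)) u) ∨ G.Ancestor (v (i + 1)) x := by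
  have := h.reverse.ancestor_of_arrow hG (i := n - (i + 1)) (by omega)
  simp only [show n - (n - (i + 1)) = i + 1 by omega,
    show n - (n - (i + 1) + 1) = i by omega] at this
  exact this harr

/-- A vertex of a walk at which there is an arrowhead is an ancestor of a collider or of an end:
if it is not a collider itself, then a directed edge of the walk leaves it. -/
theorem IsWalk.ancestor_of_into {C : V → Prop} {Z : Set V} {n : ℕ} {v : ℕ → V} {s : V}
    (hG : G.IsAncestral) (h : G.IsWalk C Z n v x y) {i : ℕ} (hi : i ≤ n) (hs : G.Into s (v i)) :
    (∃ u, C u ∧ G.Ancestor (v i) u) ∨ G.Ancestor (v i) x ∨ G.Ancestor (v i) y := by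
  rcases Nat.eq_zero_or_pos i with rfl | hpos
  · rw [h.head]
    exact Or.inr (Or.inl Relation.ReflTransGen.refl)
  obtain ⟨i, rfl⟩ : ∃ k, i = k + 1 := ⟨i - 1, by omega⟩
  rcases Nat.eq_or_lt_of_le hi with rfl | hlt
  · rw [h.last]
    exact Or.inr (Or.inr Relation.ReflTransGen.refl)
  by_cases hc : G.Coll (v i) (v (i + 1)) (v (i + 2))
  · exact Or.inl ⟨_, (h.isOpen i hlt).1 hc, Relation.ReflTransGen.refl⟩
  by_cases h₁ : G.Into (v i) (v (i + 1))
  · have := hG.arrow_of_not_into (h.adj (i + 1) hlt) (fun h' => hc ⟨h₁, h'⟩) hs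
    exact (h.ancestor_of_arrow hG hlt this).imp_right Or.inr
  · have := hG.arrow_of_not_into (h.adj i (by omega)).symm h₁ hs
    exact (h.ancestor_head_of_arrow hG (by omega) this).imp_right Or.inl

/-! ### The maximal ancestral graph of an ancestral graph -/

/-- `a` and `b` are distinct and nonadjacent, but are not m-separated by any set. -/
structure Inseparable (G : MixedGraph V) (a b : V) : Prop where
  ne : a ≠ b
  not_adj : ¬ G.Adj a b
  conn : ∀ Z, a ∉ Z → b ∉ Z → G.Conn Z a b

theorem Inseparable.symm (h : G.Inseparable a b) : G.Inseparable b a :=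
  ⟨h.ne.symm, fun h' => h.not_adj h'.symm, fun Z hb ha => (h.conn Z ha hb).symm⟩

/-- `v 0, …, v n` is an inducing walk between `a` and `b`, with at least one inner vertex: all inner
vertices are colliders and proper ancestors of an end. -/
structure IsInducing (G : MixedGraph V) (n : ℕ) (v : ℕ → V) (a b : V) : Prop where
  two_le : 2 ≤ n
  head : v 0 = a
  last : v n = b
  coll : ∀ i, i + 1 < n → G.Coll (v i) (v (i + 1)) (v (i + 2))
  anc : ∀ i, i + 1 < n →
    Relation.TransGen G.arrow (v (i + 1)) a ∨ Relation.TransGen G.arrow (v (i + 1)) b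

theorem IsInducing.adj {n : ℕ} {v : ℕ → V} (h : G.IsInducing n v a b) {i : ℕ} (hi : i < n) :
    G.Adj (v i) (v (i + 1)) := by
  have := h.two_le
  by_cases hi' : i + 1 < n
  · exact (h.coll i hi').1.adj
  · have := (h.coll (i - 1) (by omega)).2.adj.symm
    rwa [show i - 1 + 1 = i by omega, show i - 1 + 2 = i + 1 by omega] at this

theorem IsInducing.reverse {n : ℕ} {v : ℕ → V} (h : G.IsInducing n v a b) :
    G.IsInducing n (fun i => v (n - i)) b a where
  two_le := h.two_le
  head := h.last
  last := by simpa using h.head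
  coll i hi := by
    have := (h.coll (n - (i + 2)) (by omega)).symm
    rwa [show n - (i + 2) + 2 = n - i by omega, show n - (i + 2) + 1 = n - (i + 1) by omega] at this
  anc i hi := by
    have := (h.anc (n - (i + 2)) (by omega)).symm
    rwa [show n - (i + 2) + 1 = n - (i + 1) by omega] at this

/-- If the end `a` of an inducing walk is not a proper ancestor of `b`, then the walk starts with a
bi-directed edge. -/
theorem IsInducing.biarrow (hG : G.IsAncestral) {n : ℕ} {v : ℕ → V} (h : G.IsInducing n v a b)
    (hab : ¬ Relation.TransGen G.arrow a b) : G.biarrow a (v 1) := by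
  have h₂ := h.two_le
  have hc := (h.coll 0 (by omega)).1
  rw [h.head, zero_add] at hc
  rcases hc with hc | hc
  · rcases h.anc 0 (by omega) with h' | h'
    · exact absurd (Relation.TransGen.head hc h') (hG.no_directed_cycle a)
    · exact absurd (Relation.TransGen.head hc h') hab
  · exact hc

/-- The separating set to test consists of the ancestors of `a` and `b` and of all ends of
undirected edges. -/
theorem Inseparable.exists_isInducing (hG : G.IsAncestral) (h : G.Inseparable a b) :
    ∃ n v, G.IsInducing n v a b := by
  set Z : Set V := {u | u ≠ a ∧ u ≠ b ∧ (G.Ancestor u a ∨ G.Ancestor u b ∨ ∃ w, G.line u w)} with hZ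
  obtain ⟨n, v, hv⟩ := (h.conn Z (by simp [hZ]) (by simp [hZ])).exists_isShortestWalk
  have hw := hv.isWalk
  have hn : 2 ≤ n := by
    by_contra hn
    obtain rfl | rfl : n = 0 ∨ n = 1 := by omega
    · exact h.ne (hw.head.symm.trans hw.last)
    · have := hw.adj 0 (by omega)
      rw [hw.head, hw.last] at this
      exact h.not_adj this
  have hab : ∀ i, i + 1 < n → v (i + 1) ≠ a ∧ v (i + 1) ≠ b := by
    refine fun i hi => ⟨fun h' => ?_, fun h' => ?_⟩
    · rw [← hw.head] at h'
      have := hv.injective hG (by omega) (by omega) h'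
      omega
    · rw [← hw.last] at h'
      have := hv.injective hG (by omega) (by omega) h'
      omega
  have hline : ∀ i, i + 1 < n → ∀ w, ¬ G.line (v (i + 1)) w := by
    intro i hi w hl
    refine (hw.isOpen i hi).2 (fun hc => hG.not_line_of_into hc.1 _ hl) ?_
    exact ⟨(hab i hi).1, (hab i hi).2, Or.inr (Or.inr ⟨w, hl⟩)⟩
  have hanc : ∀ i, i + 1 < n → G.AncOf Z (v (i + 1)) →
      G.Ancestor (v (i + 1)) a ∨ G.Ancestor (v (i + 1)) b := by
    rintro i hi ⟨z, ⟨-, -, hz | hz | ⟨w, hz⟩⟩, hvz⟩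
    · exact Or.inl (Relation.ReflTransGen.trans hvz hz)
    · exact Or.inr (Relation.ReflTransGen.trans hvz hz)
    · rw [← hG.eq_of_ancestor_of_line hvz hz] at hz
      exact absurd hz (hline i hi w)
  have hcoll : ∀ i, i + 1 < n → G.Coll (v i) (v (i + 1)) (v (i + 2)) := by
    intro i hi
    by_contra hc
    have hs : ∃ s, G.Into s (v (i + 1)) ∨ G.arrow (v (i + 1)) (v i) := by
      rcases hw.adj i (by omega) with h' | h' | h' | h'
      · exact absurd (G.line_symm _ _ h') (hline i hi _)
      · exact ⟨_, Or.inl (Or.inl h')⟩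
      · exact ⟨a, Or.inr h'⟩
      · exact ⟨_, Or.inl (Or.inr h')⟩
    refine (hw.isOpen i hi).2 hc ⟨(hab i hi).1, (hab i hi).2, ?_⟩
    have : (∃ u, G.AncOf Z u ∧ G.Ancestor (v (i + 1)) u) ∨ G.Ancestor (v (i + 1)) a ∨
        G.Ancestor (v (i + 1)) b := by
      obtain ⟨s, hs | hs⟩ := hs
      · exact hw.ancestor_of_into hG (by omega) hs
      · exact (hw.ancestor_head_of_arrow hG (by omega) hs).imp_right Or.inl
    rcases this with ⟨u, hu, hvu⟩ | h' | h'
    · exact (hanc i hi (hu.of_ancestor hvu)).imp_right Or.inl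
    · exact Or.inl h'
    · exact Or.inr (Or.inl h')
  refine ⟨n, v, hn, hw.head, hw.last, hcoll, fun i hi => ?_⟩
  refine (hanc i hi ((hw.isOpen i hi).1 (hcoll i hi))).imp (fun h' => ?_) fun h' => ?_
  · exact h'.eq_or_transGen.resolve_left (hab i hi).1
  · exact h'.eq_or_transGen.resolve_left (hab i hi).2

/-- The maximal ancestral graph of an ancestral graph: inseparable vertices are joined by an edge
whose marks are given by the ancestor relation. -/
def completion (G : MixedGraph V) (hG : G.IsAncestral) : MixedGraph V where
  line := G.line
  arrow a b := G.arrow a b ∨ G.Inseparable a b ∧ G.Ancestor a b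
  biarrow a b := G.biarrow a b ∨ G.Inseparable a b ∧ ¬ G.Ancestor a b ∧ ¬ G.Ancestor b a
  line_symm := G.line_symm
  biarrow_symm a b h := h.imp (G.biarrow_symm _ _) fun h => ⟨h.1.symm, h.2.2, h.2.1⟩
  line_irrefl := G.line_irrefl
  arrow_irrefl a h := h.elim (G.arrow_irrefl a) fun h => h.1.ne rfl
  biarrow_irrefl a h := h.elim (G.biarrow_irrefl a) fun h => h.1.ne rfl
  arrow_asymm a b := by
    rintro (h | h) (h' | h')
    · exact G.arrow_asymm _ _ h h'
    · exact h'.1.not_adj (Or.inr (Or.inr (Or.inl h)))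
    · exact h.1.not_adj (Or.inr (Or.inr (Or.inl h')))
    · exact h.1.ne (hG.eq_of_ancestor h.2 h'.2)
  line_not_arrow a b h := by
    rintro (h' | h')
    · exact G.line_not_arrow _ _ h h'
    · exact h'.1.not_adj (Or.inl h)
  line_not_biarrow a b h := by
    rintro (h' | h')
    · exact G.line_not_biarrow _ _ h h'
    · exact h'.1.not_adj (Or.inl h)
  arrow_not_biarrow a b := by
    rintro (h | h) (h' | h')
    · exact G.arrow_not_biarrow _ _ h h'
    · exact h'.1.not_adj (Or.inr (Or.inl h))
    · exact h.1.not_adj (Or.inr (Or.inr (Or.inr h')))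
    · exact h'.2.1 h.2

section Completion

variable (hG : G.IsAncestral)
include hG

theorem isSubgraph_completion : G.IsSubgraph (G.completion hG) :=
  ⟨fun _ _ h => h, fun _ _ h => Or.inl h, fun _ _ h => Or.inl h⟩

theorem completion_adj_iff : (G.completion hG).Adj a b ↔ G.Adj a b ∨ G.Inseparable a b := by
  constructor
  · rintro (h | (h | h) | (h | h) | (h | h))
    · exact Or.inl (Or.inl h)
    · exact Or.inl (Or.inr (Or.inl h))
    · exact Or.inr h.1
    · exact Or.inl (Or.inr (Or.inr (Or.inl h)))
    · exact Or.inr h.1.symm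
    · exact Or.inl (Or.inr (Or.inr (Or.inr h)))
    · exact Or.inr h.1
  · rintro ((h | h | h | h) | h)
    · exact Or.inl h
    · exact Or.inr (Or.inl (Or.inl h))
    · exact Or.inr (Or.inr (Or.inl (Or.inl h)))
    · exact Or.inr (Or.inr (Or.inr (Or.inl h)))
    · by_cases h₁ : G.Ancestor a b
      · exact Or.inr (Or.inl (Or.inr ⟨h, h₁⟩))
      by_cases h₂ : G.Ancestor b a
      · exact Or.inr (Or.inr (Or.inl (Or.inr ⟨h.symm, h₂⟩)))
      exact Or.inr (Or.inr (Or.inr (Or.inr ⟨h, h₁, h₂⟩)))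

theorem completion_transGen_iff :
    Relation.TransGen (G.completion hG).arrow a b ↔ Relation.TransGen G.arrow a b := by
  constructor
  · intro h
    refine Relation.TransGen.trans_induction_on h ?_ fun _ _ => Relation.TransGen.trans
    rintro a b (h | h)
    · exact Relation.TransGen.single h
    · exact h.2.eq_or_transGen.resolve_left h.1.ne
  · exact fun h => Relation.TransGen.mono (fun _ _ h => Or.inl h) _ _ h

theorem completion_ancestor_iff : (G.completion hG).Ancestor a b ↔ G.Ancestor a b := by
  simp only [Ancestor, Relation.reflTransGen_iff_eq_or_transGen, completion_transGen_iff]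

/-- No vertex gets its first arrowhead in the completion. -/
theorem exists_into_of_completion_into (h : (G.completion hG).Into a b) : ∃ c, G.Into c b := by
  rcases h with (h | h) | (h | h)
  · exact ⟨a, Or.inl h⟩
  · obtain ⟨z, -, hz⟩ :=
      Relation.TransGen.tail'_iff.1 (h.2.eq_or_transGen.resolve_left h.1.ne)
    exact ⟨z, Or.inl hz⟩
  · exact ⟨a, Or.inr h⟩
  · obtain ⟨n, v, hv⟩ := h.1.symm.exists_isInducing hG
    exact ⟨_, Or.inr (G.biarrow_symm _ _ (hv.biarrow hG fun h' => h.2.2 h'.to_reflTransGen))⟩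

theorem isAncestral_completion : (G.completion hG).IsAncestral where
  no_directed_cycle x h := hG.no_directed_cycle x ((completion_transGen_iff hG).1 h)
  no_almost_directed_cycle x y h := by
    rw [completion_transGen_iff, completion_transGen_iff]
    rcases h with h | h
    · exact hG.no_almost_directed_cycle _ _ h
    · exact ⟨fun h' => h.2.1 h'.to_reflTransGen, fun h' => h.2.2 h'.to_reflTransGen⟩
  line_no_into x y h z := by
    refine ⟨fun h' => ?_, fun h' => ?_⟩
    · obtain ⟨c, hc⟩ := exists_into_of_completion_into hG h'
      exact (hG.line_no_into _ _ h c).1 hc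
    · obtain ⟨c, hc⟩ := exists_into_of_completion_into hG h'
      exact (hG.line_no_into _ _ h c).2 hc

theorem into_completion_iff_of_adj (h : G.Adj a b) : (G.completion hG).Into a b ↔ G.Into a b := by
  constructor
  · rintro ((h' | h') | (h' | h'))
    · exact Or.inl h'
    · exact absurd h h'.1.not_adj
    · exact Or.inr h'
    · exact absurd h h'.1.not_adj
  · exact Or.imp Or.inl Or.inl

/-- Every edge of the completion can be replaced by a walk of `G` with inner colliders, which keeps
the arrowheads of the edge. It may add an arrowhead at a tail of the edge. -/
theorem exists_walk_of_completion_adj (h : (G.completion hG).Adj a b) :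
    ∃ (n : ℕ) (v : ℕ → V), 0 < n ∧ v 0 = a ∧ v n = b ∧ (∀ i < n, G.Adj (v i) (v (i + 1))) ∧
      (∀ i, i + 1 < n → G.Coll (v i) (v (i + 1)) (v (i + 2)) ∧
        (Relation.TransGen G.arrow (v (i + 1)) a ∨ Relation.TransGen G.arrow (v (i + 1)) b)) ∧
      ((G.completion hG).Into b a → G.Into (v 1) a) ∧
      ((G.completion hG).Into a b → G.Into (v (n - 1)) b) := by
  rcases (completion_adj_iff hG).1 h with h' | h'
  · refine ⟨1, fun i => if i = 0 then a else b, one_pos, rfl, rfl, fun i hi => ?_, fun i hi => ?_,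
      fun h₁ => ?_, fun h₁ => ?_⟩
    · obtain rfl : i = 0 := by omega
      simpa using h'
    · omega
    · simpa using (into_completion_iff_of_adj hG h'.symm).1 h₁
    · simpa using (into_completion_iff_of_adj hG h').1 h₁
  · have key : ∀ {a b : V} {n : ℕ} {v : ℕ → V}, G.IsInducing n v a b →
        (G.completion hG).Into b a → G.Into (v 1) a := by
      intro a b n v hv h₁
      refine Or.inr (G.biarrow_symm _ _ (hv.biarrow hG fun h₂ => ?_))
      exact (isAncestral_completion hG).not_into_of_transGen ((completion_transGen_iff hG).2 h₂) h₁
    obtain ⟨n, v, hv⟩ := h'.exists_isInducing hG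
    exact ⟨n, v, by have := hv.two_le; omega, hv.head, hv.last, fun i => hv.adj,
      fun i hi => ⟨hv.coll i hi, hv.anc i hi⟩, key hv, key hv.reverse⟩

theorem Conn.completion {Z : Set V} (h : G.Conn Z x y) : (G.completion hG).Conn Z x y := by
  obtain ⟨n, v, hv⟩ := h
  refine ⟨n, v, hv.head, hv.last, fun i hi => (completion_adj_iff hG).2 (Or.inl (hv.adj i hi)),
    fun i hi => ?_⟩
  have := hv.isOpen i hi
  simpa only [Open, Coll, AncOf, completion_ancestor_iff,
    into_completion_iff_of_adj hG (hv.adj i (by omega)),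
    into_completion_iff_of_adj hG (hv.adj (i + 1) (by omega)).symm] using this

/-- When the edges of a walk in the completion are replaced by walks of `G`, a noncollider can become a
collider. Then it has an arrowhead, so that it is an ancestor of `Z` or of an end of the walk, which
is enough by `Conn.of_isWalk`. -/
theorem Conn.of_completion {Z : Set V} (h : (G.completion hG).Conn Z x y) : G.Conn Z x y := by
  have hM := isAncestral_completion hG
  obtain ⟨n, v, hv⟩ := h
  set D : V → Prop := fun u => G.AncOf Z u ∨ G.Ancestor u x ∨ G.Ancestor u y with hD
  have hDanc : ∀ u w, G.Ancestor u w → D w → D u := by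
    rintro u w huw (h | h | h)
    · exact Or.inl (h.of_ancestor huw)
    · exact Or.inr (Or.inl (Relation.ReflTransGen.trans huw h))
    · exact Or.inr (Or.inr (Relation.ReflTransGen.trans huw h))
  have hanc : ∀ u, (G.completion hG).AncOf Z u ↔ G.AncOf Z u := by
    intro u
    simp only [AncOf, completion_ancestor_iff]
  have hDof : ∀ u, ((∃ w, (G.completion hG).AncOf Z w ∧ (G.completion hG).Ancestor u w) ∨
      (G.completion hG).Ancestor u x ∨ (G.completion hG).Ancestor u y) → D u := by
    intro u
    simp only [completion_ancestor_iff, hanc]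
    rintro (⟨w, hw, huw⟩ | h)
    · exact Or.inl (hw.of_ancestor huw)
    · exact Or.inr h
  have hDinto : ∀ i ≤ n, ∀ s, G.Into s (v i) → D (v i) := fun i hi s hs =>
    hDof _ (hv.ancestor_of_into hM hi (s := s) (hs.imp Or.inl Or.inl))
  have hstep : ∀ i ≤ n, ∃ m w, G.IsWalk D Z m w x (v i) ∧ (i = 0 → m = 0) ∧
      (0 < i → (G.completion hG).Into (v (i - 1)) (v i) → G.Into (w (m - 1)) (v i)) := by
    intro i
    induction i with
    | zero =>
      intro _
      rw [hv.head]
      exact ⟨0, _, IsWalk.refl D Z x, fun _ => rfl, fun h => absurd h (lt_irrefl 0)⟩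
    | succ i ih =>
      intro hi
      obtain ⟨m, w, hw, hm₀, hm⟩ := ih (by omega)
      obtain ⟨l, t, hl, ht₀, htl, htadj, htcoll, ha, hb⟩ :=
        exists_walk_of_completion_adj hG (hv.adj i (by omega))
      have ht : G.IsWalk D Z l t (v i) (v (i + 1)) := by
        refine ⟨ht₀, htl, htadj, fun j hj =>
          ⟨fun _ => ?_, fun h => absurd (htcoll j hj).1 h⟩⟩
        have : ∀ k ≤ n, Relation.TransGen G.arrow (t (j + 1)) (v k) → D (t (j + 1)) := by
          intro k hk h
          obtain ⟨z, -, hz⟩ := Relation.TransGen.tail'_iff.1 h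
          exact hDanc _ _ h.to_reflTransGen (hDinto k hk z (Or.inl hz))
        exact (htcoll j hj).2.elim (this i (by omega)) (this (i + 1) (by omega))
      refine ⟨m + l, _, hw.append ht fun hm' _ => ?_, fun h => absurd h (by omega), fun _ h => ?_⟩
      · have hi₀ : 0 < i := by
          by_contra hi₀
          exact hm'.ne' (hm₀ (by omega))
        have hopen := hv.isOpen (i - 1) (by omega)
        rw [show i - 1 + 1 = i by omega, show i - 1 + 2 = i + 1 by omega] at hopen
        exact ⟨fun hc => hDinto i (by omega) _ hc.1, fun hc => hopen.2 fun hc' =>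
          hc ⟨hm hi₀ hc'.1, ha hc'.2⟩⟩
      · have : (if m + l - 1 ≤ m then w (m + l - 1) else t (m + l - 1 - m)) = t (l - 1) := by
          split_ifs with h
          · obtain rfl : l = 1 := by omega
            simp [hw.last, ht₀]
          · rw [show m + l - 1 - m = l - 1 by omega]
        simp only [this]
        exact hb h
  obtain ⟨m, w, hw, -⟩ := hstep n le_rfl
  rw [hv.last] at hw
  exact Conn.of_isWalk hw

theorem isMAGOf_completion : (G.completion hG).IsMAGOf G := by
  have hM := isAncestral_completion hG
  refine ⟨⟨hM, fun a b hne hadj => ?_⟩, isSubgraph_completion hG, ?_⟩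
  · by_contra hno
    push Not at hno
    refine hadj ((completion_adj_iff hG).2 (or_iff_not_imp_left.2 fun h => ⟨hne, h, ?_⟩))
    intro Z ha hb
    by_contra hZ
    exact hno Z ha hb (hM.mSep_iff.2 fun h' => hZ (h'.of_completion hG))
  · exact (markovEquiv_iff hG hM).2 fun a b Z _ _ _ => ⟨Conn.completion hG, Conn.of_completion hG⟩

/-- The marks of an additional edge of a maximal ancestral graph of `G` are forced: an inducing walk
of `G` between nonancestors starts and ends with bi-directed edges, and a vertex next to one end is
an ancestor of the other end. -/
theorem IsMAGOf.eq_completion {M : MixedGraph V} (h : M.IsMAGOf G) : M = G.completion hG := by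
  have hM := h.isMAG.ancestral
  have hsub := h.isSubgraph
  have hconn := (markovEquiv_iff hG hM).1 h.markovEquiv
  have hadj_mono : ∀ {a b}, G.Adj a b → M.Adj a b := fun {a b} =>
    Or.imp (hsub.line _ _) (Or.imp (hsub.arrow _ _) (Or.imp (hsub.arrow _ _) (hsub.biarrow _ _)))
  have htrans : ∀ {a b}, Relation.TransGen G.arrow a b → Relation.TransGen M.arrow a b :=
    fun {a b} h => Relation.TransGen.mono (fun _ _ => hsub.arrow _ _) _ _ h
  have hins : ∀ {a b}, M.Adj a b → G.Adj a b ∨ G.Inseparable a b := fun {a b} hab =>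
    or_iff_not_imp_left.2 fun hn => ⟨hab.ne, hn, fun Z ha hb =>
      (hconn a b Z hab.ne ha hb).2 (hab.conn Z)⟩
  have hadj : ∀ {a b}, G.Inseparable a b → M.Adj a b := fun {a b} hab =>
    (h.isMAG.adj_iff hab.ne).2 fun Z ha hb => (hconn a b Z hab.ne ha hb).1 (hab.conn Z ha hb)
  -- an additional directed edge comes from a directed path
  have harrow : ∀ {a b}, G.Inseparable a b → M.arrow a b → G.Ancestor a b := by
    intro a b hab hMab
    by_contra hno
    have hba : ¬ Relation.TransGen G.arrow b a := fun h' =>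
      hM.no_directed_cycle a (Relation.TransGen.head hMab (htrans h'))
    obtain ⟨n, v, hv⟩ := hab.symm.exists_isInducing hG
    have hbi := hv.biarrow hG hba
    have h₂ := hv.two_le
    rcases hv.anc 0 (by omega) with h' | h'
    · exact (hG.no_almost_directed_cycle _ _ hbi).2 h'
    · exact (hM.no_almost_directed_cycle _ _ (hsub.biarrow _ _ hbi)).2 ((htrans h').tail hMab)
  have hGarrow : ∀ {a b}, G.Adj a b → M.arrow a b → G.arrow a b := by
    rintro a b (h' | h' | h' | h') hab
    · exact absurd hab (M.line_not_arrow _ _ (hsub.line _ _ h'))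
    · exact h'
    · exact absurd hab (M.arrow_asymm _ _ (hsub.arrow _ _ h'))
    · exact absurd (hsub.biarrow _ _ h') (M.arrow_not_biarrow _ _ hab)
  have hGbi : ∀ {a b}, G.Adj a b → M.biarrow a b → G.biarrow a b := by
    rintro a b (h' | h' | h' | h') hab
    · exact absurd hab (M.line_not_biarrow _ _ (hsub.line _ _ h'))
    · exact absurd hab (M.arrow_not_biarrow _ _ (hsub.arrow _ _ h'))
    · exact absurd (M.biarrow_symm _ _ hab) (M.arrow_not_biarrow _ _ (hsub.arrow _ _ h'))
    · exact h'
  have hGline : ∀ {a b}, G.Adj a b → M.line a b → G.line a b := by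
    rintro a b (h' | h' | h' | h') hab
    · exact h'
    · exact absurd (hsub.arrow _ _ h') (M.line_not_arrow _ _ hab)
    · exact absurd (hsub.arrow _ _ h') (M.line_not_arrow _ _ (M.line_symm _ _ hab))
    · exact absurd (hsub.biarrow _ _ h') (M.line_not_biarrow _ _ hab)
  have hanc : ∀ {a b}, G.Inseparable a b → G.Ancestor a b → M.arrow a b := fun {a b} hab h' =>
    hM.arrow_of_transGen (htrans (h'.eq_or_transGen.resolve_left hab.ne)) (hadj hab)
  ext a b
  · refine ⟨fun h' => ?_, hsub.line _ _⟩
    rcases hins (Or.inl h') with h'' | h''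
    · exact hGline h'' h'
    · by_cases hab : Relation.TransGen G.arrow a b
      · exact absurd (hanc h'' hab.to_reflTransGen) (M.line_not_arrow _ _ h')
      · obtain ⟨n, v, hv⟩ := h''.exists_isInducing hG
        have hbi := G.biarrow_symm _ _ (hv.biarrow hG hab)
        exact absurd h' (hM.not_line_of_into (Or.inr (hsub.biarrow _ _ hbi)) b)
  · constructor
    · intro h'
      rcases hins (Or.inr (Or.inl h')) with h'' | h''
      · exact Or.inl (hGarrow h'' h')
      · exact Or.inr ⟨h'', harrow h'' h'⟩
    · rintro (h' | ⟨h', h''⟩)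
      · exact hsub.arrow _ _ h'
      · exact hanc h' h''
  · constructor
    · intro h'
      rcases hins (Or.inr (Or.inr (Or.inr h'))) with h'' | h''
      · exact Or.inl (hGbi h'' h')
      · exact Or.inr ⟨h'', fun h₁ => M.arrow_not_biarrow _ _ (hanc h'' h₁) h',
          fun h₁ => M.arrow_not_biarrow _ _ (hanc h''.symm h₁) (M.biarrow_symm _ _ h')⟩
    · rintro (h' | ⟨h', h₁, h₂⟩)
      · exact hsub.biarrow _ _ h'
      · obtain ⟨n, v, hv⟩ := h'.exists_isInducing hG
        have hbi := hsub.biarrow _ _ (hv.biarrow hG fun h'' => h₁ h''.to_reflTransGen)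
        rcases hadj h' with h'' | h'' | h'' | h''
        · exact absurd h'' (hM.not_line_of_into (Or.inr (M.biarrow_symm _ _ hbi)) b)
        · exact absurd (harrow h' h'') h₁
        · exact absurd (harrow h'.symm h'') h₂
        · exact h''

end Completion

/-! ### Discriminating paths -/

/-- `v 0, …, v p, v (p + 1), y` is a discriminating path for `v (p + 1)`. The case `p = 0` is allowed
here: then it is an unshielded triple. -/
structure IsDisc (G : MixedGraph V) (v : ℕ → V) (p : ℕ) (y : V) : Prop where
  adj : ∀ i < p + 1, G.Adj (v i) (v (i + 1))
  inj : ∀ i j, i ≤ p + 1 → j ≤ p + 1 → v i = v j → i = j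
  ne : ∀ i ≤ p + 1, v i ≠ y
  not_adj : ¬ G.Adj (v 0) y
  adj_last : G.Adj (v (p + 1)) y
  coll : ∀ i < p, G.Coll (v i) (v (i + 1)) (v (i + 2))
  arrow : ∀ i < p, G.arrow (v (i + 1)) y

/-- The triples that have some order, without counting the order. -/
inductive Ordered (G : MixedGraph V) : V → V → V → Prop
  | disc (v : ℕ → V) (p : ℕ) (y : V) (h : G.IsDisc v p y)
      (ho : ∀ i < p, Ordered G (v i) (v (i + 1)) (v (i + 2))) : Ordered G (v p) (v (p + 1)) y
  | symm (a b c : V) (h : Ordered G a b c) : Ordered G c b a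

theorem IsDisc.of_unshielded (hne : a ≠ c) (hab : G.Adj a b) (hbc : G.Adj b c)
    (hac : ¬ G.Adj a c) : G.IsDisc (fun i => if i = 0 then a else b) 0 c where
  adj i hi := by
    obtain rfl : i = 0 := by omega
    simpa using hab
  inj i j hi hj h := by
    obtain ⟨rfl | rfl, rfl | rfl⟩ : (i = 0 ∨ i = 1) ∧ (j = 0 ∨ j = 1) := by omega
    · rfl
    · exact absurd h hab.ne
    · exact absurd h hab.ne.symm
    · rfl
  ne i hi := by
    obtain rfl | rfl : i = 0 ∨ i = 1 := by omega
    · exact hne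
    · exact hbc.ne
  not_adj := hac
  adj_last := hbc
  coll i hi := absurd hi (by omega)
  arrow i hi := absurd hi (by omega)

theorem Ordered.of_unshielded (hne : a ≠ c) (hab : G.Adj a b) (hbc : G.Adj b c)
    (hac : ¬ G.Adj a c) : G.Ordered a b c :=
  Ordered.disc _ 0 c (IsDisc.of_unshielded hne hab hbc hac) fun i hi => absurd hi (by omega)

theorem Ordered.ne (h : G.Ordered a b c) : a ≠ c := by
  induction h with
  | disc v p y h ho ih => exact h.ne p (by omega)
  | symm a b c h ih => exact ih.symm

namespace IsDisc

variable {v : ℕ → V} {p : ℕ} {Z : Set V}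

theorem take (h : G.IsDisc v p y) {k : ℕ} (hk : k < p) : G.IsDisc v k y where
  adj i hi := h.adj i (by omega)
  inj i j hi hj := h.inj i j (by omega) (by omega)
  ne i hi := h.ne i (by omega)
  not_adj := h.not_adj
  adj_last := Or.inr (Or.inl (h.arrow k hk))
  coll i hi := h.coll i (by omega)
  arrow i hi := h.arrow i (by omega)

theorem conn (h : G.IsDisc v p y) (hZ : ∀ i < p, v (i + 1) ∈ Z)
    (hopen : G.Open (G.AncOf Z) Z (v p) (v (p + 1)) y) : G.Conn Z (v 0) y := by
  have hw : G.IsWalk (G.AncOf Z) Z (p + 1) v (v 0) (v (p + 1)) :=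
    ⟨rfl, rfl, h.adj, fun i hi => ⟨fun _ => ⟨_, hZ i (by omega), Relation.ReflTransGen.refl⟩,
      fun hc => absurd (h.coll i (by omega)) hc⟩⟩
  exact ⟨_, _, hw.append (IsWalk.edge _ Z h.adj_last) fun _ _ => by simpa using hopen⟩

theorem mem (h : G.IsDisc v p y) (hZ : ¬ G.Conn Z (v 0) y) : ∀ i < p, v (i + 1) ∈ Z := by
  intro i
  induction i using Nat.strong_induction_on with
  | _ i ih =>
    intro hi
    by_contra hno
    exact hZ ((h.take hi).conn (fun j hj => ih j hj (by omega))
      ⟨fun hc => absurd hc.2 (not_into_of_arrow (h.arrow i hi)), fun _ => hno⟩)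

/-- A set that separates the ends of a discriminating path contains the discriminated vertex exactly
if this is a noncollider. -/
theorem coll_iff (h : G.IsDisc v p y) (hZ : ¬ G.Conn Z (v 0) y) :
    G.Coll (v p) (v (p + 1)) y ↔ v (p + 1) ∉ Z := by
  constructor
  · intro hc hmem
    exact hZ (h.conn (h.mem hZ)
      ⟨fun _ => ⟨_, hmem, Relation.ReflTransGen.refl⟩, fun hc' => absurd hc hc'⟩)
  · intro hmem
    by_contra hc
    exact hZ (h.conn (h.mem hZ) ⟨fun hc' => absurd hc' hc, fun _ => hmem⟩)

/-- A discriminating path of `G` is one of `H` if its colliders are colliders of `H` and if those of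
its initial segments that are discriminating in `H` discriminate noncolliders. -/
theorem transfer {H : MixedGraph V} (hH : H.IsAncestral) (hadj : G.SameAdjacencies H)
    (h : G.IsDisc v p y) (hcoll : ∀ i < p, H.Coll (v i) (v (i + 1)) (v (i + 2)))
    (hnc : ∀ k < p, H.IsDisc v k y → ¬ H.Coll (v k) (v (k + 1)) y) : H.IsDisc v p y := by
  have key : ∀ k, k ≤ p → H.IsDisc v k y := by
    intro k
    induction k with
    | zero =>
      intro _
      refine ⟨fun i hi => (hadj _ _).1 (h.adj i (by omega)),
        fun i j hi hj => h.inj i j (by omega) (by omega), fun i hi => h.ne i (by omega),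
        fun h' => h.not_adj ((hadj _ _).2 h'), (hadj _ _).1 ?_,
        fun i hi => absurd hi (by omega), fun i hi => absurd hi (by omega)⟩
      rcases Nat.eq_zero_or_pos p with rfl | hp
      · exact h.adj_last
      · exact (h.take hp).adj_last
    | succ k ih =>
      intro hk
      have hd := ih (by omega)
      have hinto := (hcoll k (by omega)).1
      have harr : H.arrow (v (k + 1)) y := hH.arrow_of_not_into hd.adj_last
        (fun h' => hnc k (by omega) hd ⟨hinto, h'⟩) hinto
      refine ⟨fun i hi => (hadj _ _).1 (h.adj i (by omega)),
        fun i j hi hj => h.inj i j (by omega) (by omega), fun i hi => h.ne i (by omega),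
        hd.not_adj, (hadj _ _).1 ?_, fun i hi => hcoll i (by omega), fun i hi => ?_⟩
      · rcases Nat.eq_or_lt_of_le hk with rfl | hk
        · exact h.adj_last
        · exact (h.take hk).adj_last
      · rcases Nat.eq_or_lt_of_le (show i ≤ k by omega) with rfl | hi'
        · exact harr
        · exact hd.arrow i hi'
  exact key p le_rfl

end IsDisc

/-! ### Triples with order -/

theorem cons_map_range_append (v : ℕ → V) (k : ℕ) (l : List V) :
    v 0 :: ((List.range k).map (fun i => v (i + 1)) ++ v (k + 1) :: v (k + 2) :: l) =
      (List.range (k + 3)).map v ++ l := by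
  rw [List.range_succ, List.range_succ, List.range_succ_eq_map]
  simp [Function.comp_def]

theorem map_range_append_singleton (v : ℕ → V) (n : ℕ) (y : V) :
    (List.range n).map v ++ [y] = (List.range (n + 1)).map fun i => if i < n then v i else y := by
  rw [List.range_succ, List.map_append]
  congr 1
  · refine List.map_congr_left fun i hi => ?_
    rw [if_pos (List.mem_range.1 hi)]
  · simp

theorem isDiscriminating_iff {v : ℕ → V} {k : ℕ} :
    G.IsDiscriminating (v 0) ((List.range k).map fun i => v (i + 1)) (v (k + 1)) (v (k + 2)) y ↔
      G.IsDisc v (k + 1) y := by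
  have hmem : ∀ u, u ∈ (List.range k).map (fun i => v (i + 1)) ++ [v (k + 1)] ↔
      ∃ i < k + 1, v (i + 1) = u := by
    intro u
    simp only [List.mem_append, List.mem_map, List.mem_range, List.mem_singleton]
    constructor
    · rintro (⟨i, hi, rfl⟩ | rfl)
      · exact ⟨i, by omega, rfl⟩
      · exact ⟨k, by omega, rfl⟩
    · rintro ⟨i, hi, rfl⟩
      rcases Nat.eq_or_lt_of_le (show i ≤ k by omega) with rfl | hi
      · exact Or.inr rfl
      · exact Or.inl ⟨i, hi, rfl⟩
  constructor
  · rintro ⟨h₁, h₂, h₃, h₄⟩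
    rw [cons_map_range_append, map_range_append_singleton, isPath_map_range] at h₁
    rw [cons_map_range_append, List.append_nil] at h₃
    obtain ⟨-, -, ha, hi⟩ := h₁
    refine ⟨fun i hi => ?_, fun i j hi' hj' h => ?_, fun i hi' h => ?_, h₂, ?_, fun i hi => ?_,
      fun i hi => ?_⟩
    · have := ha i (by omega)
      rwa [if_pos (by omega), if_pos (by omega)] at this
    · refine hi i j (by omega) (by omega) ?_
      rwa [if_pos (by omega), if_pos (by omega)]
    · have := hi i (k + 3) (by omega) (by omega) (by rwa [if_pos (by omega), if_neg (by omega)])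
      omega
    · have := ha (k + 2) (by omega)
      rwa [if_pos (by omega), if_neg (by omega)] at this
    · exact (isCollider_iff.1
        (h₃ _ _ _ (triple_infix_map_range.2 ⟨i, by omega, rfl, rfl, rfl⟩))).2
    · exact h₄ _ ((hmem _).2 ⟨i, hi, rfl⟩)
  · intro h
    refine ⟨?_, h.not_adj, fun u w t hi => ?_, fun u hu => ?_⟩
    · rw [cons_map_range_append, map_range_append_singleton, isPath_map_range]
      refine ⟨if_pos (by omega), if_neg (by omega), fun i hi => ?_, fun i j hi hj => ?_⟩
      · rw [if_pos (by omega)]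
        split_ifs with hi'
        · exact h.adj i (by omega)
        · obtain rfl : i = k + 2 := by omega
          exact h.adj_last
      · split_ifs with h₁ h₂ h₂
        · exact h.inj i j (by omega) (by omega)
        · exact fun h' => absurd h' (h.ne i (by omega))
        · exact fun h' => absurd h'.symm (h.ne j (by omega))
        · omega
    · rw [cons_map_range_append, List.append_nil] at hi
      obtain ⟨i, hi, rfl, rfl, rfl⟩ := triple_infix_map_range.1 hi
      refine isCollider_iff.2 ⟨fun h' => ?_, h.coll i (by omega)⟩
      have := h.inj i (i + 2) (by omega) (by omega) h'
      omega
    · obtain ⟨i, hi, rfl⟩ := (hmem u).1 hu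
      exact h.arrow i hi

theorem exists_eq_cons_map_range (x : V) (qs : List V) (q b : V) :
    ∃ (v : ℕ → V) (k : ℕ), x = v 0 ∧ qs = (List.range k).map (fun i => v (i + 1)) ∧
      q = v (k + 1) ∧ b = v (k + 2) := by
  refine ⟨fun i => (x :: (qs ++ [q, b])).getD i x, qs.length, rfl, ?_, by simp, by simp⟩
  conv_lhs => rw [exists_eq_map_range qs x]
  refine List.map_congr_left fun i hi => ?_
  simp [List.getElem?_append_left (List.mem_range.1 hi)]

theorem HasOrderEq.ordered {i : ℕ} : ∀ {a b c : V}, G.HasOrderEq i a b c → G.Ordered a b c := by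
  induction i using Nat.strong_induction_on with
  | _ i ih =>
    intro a b c h
    cases i with
    | zero =>
      rw [HasOrderEq, isTriple_iff] at h
      exact Ordered.of_unshielded h.1.1 h.1.2.1 h.1.2.2 h.2
    | succ i =>
      rw [HasOrderEq] at h
      obtain ⟨-, x, qs, q, y, heq, hd, hi⟩ := h
      have key : G.Ordered q b y := by
        obtain ⟨v, k, rfl, rfl, rfl, rfl⟩ := exists_eq_cons_map_range x qs q b
        rw [cons_map_range_append, List.append_nil] at hi
        refine Ordered.disc v (k + 1) y (isDiscriminating_iff.1 hd) fun j hj => ?_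
        obtain ⟨l, hl, h⟩ := hi _ _ _ (triple_infix_map_range.2 ⟨j, by omega, rfl, rfl, rfl⟩)
        exact ih l (by omega) h
      rcases heq with ⟨rfl, rfl⟩ | ⟨rfl, rfl⟩
      · exact key
      · exact key.symm

theorem HasOrderEq.symm {i : ℕ} : ∀ {a b c : V}, G.HasOrderEq i a b c → G.HasOrderEq i c b a := by
  induction i using Nat.strong_induction_on with
  | _ i ih =>
    intro a b c h
    cases i with
    | zero =>
      rw [HasOrderEq, isTriple_iff] at h ⊢
      exact ⟨⟨h.1.1.symm, h.1.2.2.symm, h.1.2.1.symm⟩, fun h' => h.2 h'.symm⟩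
    | succ i =>
      rw [HasOrderEq] at h ⊢
      obtain ⟨hno, x, qs, q, y, heq, hd⟩ := h
      exact ⟨fun j hj h' => hno j hj (ih j hj h'), x, qs, q, y, by tauto, hd⟩

theorem Ordered.exists_hasOrderEq (h : G.Ordered a b c) : ∃ i, G.HasOrderEq i a b c := by
  induction h with
  | symm a b c h ih => exact ih.imp fun i => HasOrderEq.symm
  | disc v p y h ho ih =>
    cases p with
    | zero =>
      refine ⟨0, ?_⟩
      rw [HasOrderEq, isTriple_iff]
      exact ⟨⟨h.ne 0 (by omega), h.adj 0 (by omega), h.adj_last⟩, h.not_adj⟩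
    | succ k =>
      by_cases hex : ∃ i, G.HasOrderEq i (v (k + 1)) (v (k + 1 + 1)) y
      · exact hex
      choose! f hf using ih
      refine ⟨(Finset.range (k + 1)).sup f + 1, ?_⟩
      rw [HasOrderEq]
      refine ⟨fun j _ hj => hex ⟨j, hj⟩, v 0, (List.range k).map fun i => v (i + 1), v (k + 1), y,
        Or.inl ⟨rfl, rfl⟩, isDiscriminating_iff.2 h, fun u w t hi => ?_⟩
      rw [cons_map_range_append, List.append_nil] at hi
      obtain ⟨i, hi, rfl, rfl, rfl⟩ := triple_infix_map_range.1 hi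
      exact ⟨f i, Finset.le_sup (Finset.mem_range.2 (by omega)), hf i (by omega)⟩

theorem isColliderWithOrder_iff : G.IsColliderWithOrder a b c ↔ G.Coll a b c ∧ G.Ordered a b c := by
  rw [IsColliderWithOrder, isCollider_iff]
  constructor
  · rintro ⟨⟨-, h⟩, i, hi⟩
    exact ⟨h, hi.ordered⟩
  · rintro ⟨h, ho⟩
    exact ⟨⟨ho.ne, h⟩, ho.exists_hasOrderEq⟩

/-! ### Invariance of the colliders with order -/

variable {H : MixedGraph V}

theorem IsMAG.sameAdjacencies (hG : G.IsMAG) (hH : H.IsMAG) (h : G.MarkovEquiv H) :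
    G.SameAdjacencies H := by
  intro a b
  rcases eq_or_ne a b with rfl | hab
  · exact iff_of_false (not_adj_self a) (not_adj_self a)
  rw [hG.adj_iff hab, hH.adj_iff hab]
  exact forall₃_congr fun Z ha hb =>
    (markovEquiv_iff hG.ancestral hH.ancestral).1 h a b Z hab ha hb

/-- The ends of a discriminating path are nonadjacent and hence separated by some set, which by
`IsDisc.coll_iff` shows whether the discriminated vertex is a collider. -/
theorem IsMAG.ordered_of_markovEquiv (hG : G.IsMAG) (hH : H.IsMAG) (h : G.MarkovEquiv H)
    (ho : G.Ordered a b c) : H.Ordered a b c ∧ (G.Coll a b c ↔ H.Coll a b c) := by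
  induction ho with
  | symm a b c ho ih => exact ⟨ih.1.symm, by rw [coll_comm, ih.2, coll_comm]⟩
  | disc v p y hd ho ih =>
    obtain ⟨Z, hx, hy, hZ⟩ := hG.maximal _ _ (hd.ne 0 (by omega)) hd.not_adj
    rw [hG.ancestral.mSep_iff] at hZ
    have hZ' : ¬ H.Conn Z (v 0) y := by
      rwa [← (markovEquiv_iff hG.ancestral hH.ancestral).1 h _ _ _ (hd.ne 0 (by omega)) hx hy]
    have hd' : H.IsDisc v p y := by
      refine hd.transfer hH.ancestral (hG.sameAdjacencies hH h)
        (fun i hi => (ih i hi).2.1 (hd.coll i hi)) fun k hk hk' hc => ?_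
      exact (hk'.coll_iff hZ').1 hc (hd.mem hZ k hk)
    exact ⟨Ordered.disc v p y hd' fun i hi => (ih i hi).1,
      by rw [hd.coll_iff hZ, hd'.coll_iff hZ']⟩

theorem ordered_of_sameCollidersWithOrder (hH : H.IsAncestral) (hadj : G.SameAdjacencies H)
    (hc : G.SameCollidersWithOrder H) (ho : G.Ordered a b c) :
    H.Ordered a b c ∧ (G.Coll a b c ↔ H.Coll a b c) := by
  simp only [SameCollidersWithOrder, isColliderWithOrder_iff] at hc
  suffices h : H.Ordered a b c from
    ⟨h, fun h' => ((hc _ _ _).1 ⟨h', ho⟩).1, fun h' => ((hc _ _ _).2 ⟨h', h⟩).1⟩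
  induction ho with
  | symm a b c ho ih => exact ih.symm
  | disc v p y hd ho ih =>
    refine Ordered.disc v p y (hd.transfer hH hadj (fun i hi =>
      ((hc _ _ _).1 ⟨hd.coll i hi, ho i hi⟩).1) fun k hk hk' hcoll => ?_) ih
    have := (hc _ _ _).2 ⟨hcoll, Ordered.disc v k y hk' fun i hi => ih i (by omega)⟩
    exact not_into_of_arrow (hd.arrow k hk) this.1.2

/-! ### Triples of shortest walks have an order -/

variable {Z : Set V} {n : ℕ} {v : ℕ → V}

/-- A walk can be joined to a vertex `y` next to `v p`, bypassing `v (p + 1)`, possibly after going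
back along it to some `v j`, unless there is a discriminating path for `v (p + 1)` that consists of
a part of the walk and `y`. Going back from a vertex is necessary if the edge to `y` makes it a
noncollider, while it is a collider of the walk and in `Z`; then it is a parent of `y`. -/
theorem IsWalk.bypass (hG : G.IsAncestral) (hw : G.IsWalk (G.AncOf Z) Z n v a b) {p : ℕ}
    (hp : p + 1 ≤ n) (hinto : G.Into (v p) y) (htail : G.arrow (v p) (v (p + 1)) → G.arrow (v p) y) :
    (∃ j ≤ p, G.Into (v j) y ∧ (0 < j → G.Open (G.AncOf Z) Z (v (j - 1)) (v j) y)) ∨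
      ∃ j < p, ¬ G.Adj (v j) y ∧
        ∀ m, j < m → m ≤ p → G.arrow (v m) y ∧ G.Coll (v (m - 1)) (v m) (v (m + 1)) := by
  induction p with
  | zero => exact Or.inl ⟨0, le_rfl, hinto, fun h => absurd h (lt_irrefl 0)⟩
  | succ p ih =>
    by_cases ho : G.Open (G.AncOf Z) Z (v p) (v (p + 1)) y
    · exact Or.inl ⟨p + 1, le_rfl, hinto, fun _ => ho⟩
    have ho' := hw.isOpen p (by omega)
    have key : G.arrow (v (p + 1)) y ∧ G.Coll (v p) (v (p + 1)) (v (p + 2)) := by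
      by_cases hc : G.Coll (v p) (v (p + 1)) y
      · exfalso
        by_cases hc' : G.Coll (v p) (v (p + 1)) (v (p + 2))
        · exact ho ⟨fun _ => ho'.1 hc', fun h => absurd hc h⟩
        · have := hG.arrow_of_not_into (hw.adj (p + 1) (by omega)) (fun h => hc' ⟨hc.1, h⟩) hc.1
          exact not_into_of_arrow (htail this) hc.2
      · have hc' : G.Coll (v p) (v (p + 1)) (v (p + 2)) := by
          by_contra hc'
          exact ho ⟨fun h => absurd h hc, fun _ => ho'.2 hc'⟩
        exact ⟨hG.arrow_of_not_into hinto.adj (fun h => hc ⟨hc'.1, h⟩) hc'.1, hc'⟩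
    by_cases hadj : G.Adj (v p) y
    · rcases ih (by omega) (hG.into_of_into_arrow key.2.1 key.1 hadj)
        (fun h => hG.arrow_trans h key.1 hadj) with ⟨j, hj, h⟩ | ⟨j, hj, hjy, h⟩
      · exact Or.inl ⟨j, by omega, h⟩
      · refine Or.inr ⟨j, by omega, hjy, fun m hm hm' => ?_⟩
        rcases Nat.eq_or_lt_of_le hm' with rfl | hm'
        · exact key
        · exact h m hm (by omega)
    · refine Or.inr ⟨p, by omega, hadj, fun m hm hm' => ?_⟩
      obtain rfl : m = p + 1 := by omega
      exact key

/-- The part of a walk between two vertices is replaced by an edge. -/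
theorem IsWalk.shortcut {C : V → Prop} (hw : G.IsWalk C Z n v a b) {j k : ℕ} (hj : j ≤ n)
    (hk : k ≤ n) (hadj : G.Adj (v j) (v k)) (ho : 0 < j → G.Open C Z (v (j - 1)) (v j) (v k))
    (ho' : k < n → G.Open C Z (v j) (v k) (v (k + 1))) :
    ∃ w, G.IsWalk C Z (j + 1 + (n - k)) w a b := by
  refine ⟨_, ((hw.take hj).append (IsWalk.edge C Z hadj) fun hj' _ => ?_).append (hw.drop hk)
    fun _ hk' => ?_⟩
  · simpa using ho hj'
  · simpa using ho' (by omega)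

/-- The part of a walk between two vertices is replaced by two edges through `y`. -/
theorem IsWalk.detour {C : V → Prop} (hw : G.IsWalk C Z n v a b) {j k : ℕ} (hj : j ≤ n)
    (hk : k ≤ n) (hjy : G.Adj (v j) y) (hky : G.Adj y (v k))
    (ho : 0 < j → G.Open C Z (v (j - 1)) (v j) y) (hy : G.Open C Z (v j) y (v k))
    (ho' : k < n → G.Open C Z y (v k) (v (k + 1))) :
    ∃ w, G.IsWalk C Z (j + 1 + (1 + (n - k))) w a b := by
  refine ⟨_, ((hw.take hj).append (IsWalk.edge C Z hjy) fun hj' _ => ?_).append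
    ((IsWalk.edge C Z hky).append (hw.drop hk) fun _ hk' => ?_) fun _ _ => ?_⟩
  · simpa using ho hj'
  · simpa using ho' (by omega)
  · simpa using hy

theorem IsShortestWalk.reverse (h : G.IsShortestWalk Z n v a b) :
    G.IsShortestWalk Z n (fun i => v (n - i)) b a :=
  ⟨h.isWalk.reverse, fun _ _ hw => h.le _ _ hw.reverse⟩

/-- If the shortcut from `v p` to `v (p + 2)` in a shortest walk fails at `v p`, then there is a
discriminating path for `v (p + 1)` that is a part of the walk, with the end `v (p + 2)`. -/
theorem IsShortestWalk.exists_left_of_not_open (hG : G.IsAncestral)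
    (h : G.IsShortestWalk Z n v a b) {p : ℕ} (hp : p + 2 ≤ n) (hadj : G.Adj (v p) (v (p + 2)))
    (hp₀ : 0 < p) (ho : ¬ G.Open (G.AncOf Z) Z (v (p - 1)) (v p) (v (p + 2))) :
    ∃ j < p, ¬ G.Adj (v j) (v (p + 2)) ∧ ∀ m, j < m → m ≤ p →
      G.arrow (v m) (v (p + 2)) ∧ G.Coll (v (m - 1)) (v m) (v (m + 1)) := by
  have hw := h.isWalk
  have o₁ := hw.isOpen (p - 1) (by omega)
  rw [show p - 1 + 1 = p by omega, show p - 1 + 2 = p + 1 by omega] at o₁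
  have o₂ := hw.isOpen p (by omega)
  by_cases hc : G.Coll (v (p - 1)) (v p) (v (p + 2))
  · exfalso
    have hZ : ¬ G.AncOf Z (v p) := fun h' => ho ⟨fun _ => h', fun h'' => absurd hc h''⟩
    have a₁ : G.arrow (v p) (v (p + 1)) :=
      hG.arrow_of_not_into (hw.adj p (by omega)) (fun h' => hZ (o₁.1 ⟨hc.1, h'⟩)) hc.1
    have a₂ : G.arrow (v (p + 1)) (v (p + 2)) :=
      hG.arrow_of_not_into (hw.adj (p + 1) (by omega)) (fun h' => hZ
        ((o₂.1 ⟨Or.inl a₁, h'⟩).of_ancestor (Relation.ReflTransGen.single a₁))) (Or.inl a₁)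
    exact hG.not_into_of_transGen ((Relation.TransGen.single a₁).tail a₂) hc.2
  · have hc' : G.Coll (v (p - 1)) (v p) (v (p + 1)) := by
      by_contra hc'
      exact ho ⟨fun h' => absurd h' hc, fun _ => o₁.2 hc'⟩
    have harr : G.arrow (v p) (v (p + 2)) :=
      hG.arrow_of_not_into hadj (fun h' => hc ⟨hc'.1, h'⟩) hc'.1
    refine (hw.bypass hG (by omega) (Or.inl harr) fun _ => harr).resolve_left ?_
    rintro ⟨j, hj, hjinto, hjo⟩
    have hinto : G.Into (v (p + 1)) (v (p + 2)) := by
      by_contra hn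
      have := hG.arrow_of_not_into (hw.adj (p + 1) (by omega)).symm hn (Or.inl harr)
      exact hG.not_into_of_transGen ((Relation.TransGen.single harr).tail this) hc'.2
    obtain ⟨w, hw'⟩ := hw.shortcut (j := j) (k := p + 2) (by omega) hp hjinto.adj hjo fun hlt => by
      have o₃ := hw.isOpen (p + 1) (by omega)
      exact ⟨fun h' => o₃.1 ⟨hinto, h'.2⟩, fun h' => o₃.2 fun h'' => h' ⟨hjinto, h''.2⟩⟩
    have := h.le _ _ hw'
    omega

/-- A shielded triple of a shortest walk is discriminated by a part of the walk, to its left or to its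
right, as otherwise it could be cut short. -/
theorem IsShortestWalk.shielded (hG : G.IsAncestral)
    (h : G.IsShortestWalk Z n v a b) {p : ℕ} (hp : p + 2 ≤ n) (hadj : G.Adj (v p) (v (p + 2))) :
    (∃ j < p, ¬ G.Adj (v j) (v (p + 2)) ∧ ∀ m, j < m → m ≤ p →
      G.arrow (v m) (v (p + 2)) ∧ G.Coll (v (m - 1)) (v m) (v (m + 1))) ∨
    ∃ k ≤ n, p + 2 < k ∧ ¬ G.Adj (v k) (v p) ∧ ∀ m, p + 2 ≤ m → m < k →
      G.arrow (v m) (v p) ∧ G.Coll (v (m - 1)) (v m) (v (m + 1)) := by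
  by_cases h₁ : 0 < p → G.Open (G.AncOf Z) Z (v (p - 1)) (v p) (v (p + 2))
  · by_cases h₂ : p + 2 < n → G.Open (G.AncOf Z) Z (v p) (v (p + 2)) (v (p + 3))
    · obtain ⟨w, hw⟩ := h.isWalk.shortcut (by omega) hp hadj h₁ h₂
      have := h.le _ _ hw
      omega
    · push Not at h₂
      obtain ⟨j, hj, hja, hjm⟩ := h.reverse.exists_left_of_not_open hG (p := n - (p + 2)) (by omega)
        (by
          simp only [show n - (n - (p + 2)) = p + 2 by omega,
            show n - (n - (p + 2) + 2) = p by omega]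
          exact hadj.symm)
        (by omega)
        (by
          simp only [show n - (n - (p + 2)) = p + 2 by omega,
            show n - (n - (p + 2) + 2) = p by omega, show n - (n - (p + 2) - 1) = p + 3 by omega]
          exact fun h' => h₂.2 h'.symm)
      simp only [show n - (n - (p + 2) + 2) = p by omega] at hja hjm
      refine Or.inr ⟨n - j, by omega, by omega, hja, fun m hm hm' => ?_⟩
      have := hjm (n - m) (by omega) (by omega)
      rw [show n - (n - m) = m by omega, show n - (n - m - 1) = m + 1 by omega,
        show n - (n - m + 1) = m - 1 by omega] at this
      exact ⟨this.1, this.2.symm⟩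
  · push Not at h₁
    exact Or.inl (h.exists_left_of_not_open hG hp hadj h₁.1 h₁.2)

/-- A part `v j, …, v p, v (p + 1)` of a shortest walk with inner colliders that are parents of `y`
is a discriminating path together with `y`. -/
theorem IsShortestWalk.isDisc (hG : G.IsAncestral) (h : G.IsShortestWalk Z n v a b) {j p : ℕ}
    (hj : j < p) (hp : p + 1 ≤ n) (hjy : ¬ G.Adj (v j) y) (hpy : G.Adj (v (p + 1)) y)
    (hm : ∀ m, j < m → m ≤ p → G.arrow (v m) y ∧ G.Coll (v (m - 1)) (v m) (v (m + 1))) :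
    G.IsDisc (fun i => v (j + i)) (p - j) y where
  adj i hi := h.isWalk.adj (j + i) (by omega)
  inj i i' hi hi' h' := by
    have := h.injective hG (by omega) (by omega) h'
    omega
  ne i hi := by
    rcases Nat.eq_zero_or_pos i with rfl | hi₀
    · rintro rfl
      have := hm (j + 1) (by omega) (by omega)
      exact not_into_of_arrow this.1 this.2.1
    · rcases Nat.lt_or_ge (j + i) (p + 1) with hi' | hi'
      · exact (show G.Adj (v (j + i)) y from
          Or.inr (Or.inl (hm (j + i) (by omega) (by omega)).1)).ne
      · rw [show j + i = p + 1 by omega]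
        exact hpy.ne
  not_adj := hjy
  adj_last := by
    rwa [show j + (p - j + 1) = p + 1 by omega]
  coll i hi := (hm (j + (i + 1)) (by omega) (by omega)).2
  arrow i hi := (hm (j + (i + 1)) (by omega) (by omega)).1

theorem IsShortestWalk.ordered_left (hG : G.IsAncestral) (h : G.IsShortestWalk Z n v a b) {j p : ℕ}
    (hj : j < p) (hp : p + 1 ≤ n) (hjy : ¬ G.Adj (v j) y) (hpy : G.Adj (v (p + 1)) y)
    (hm : ∀ m, j < m → m ≤ p → G.arrow (v m) y ∧ G.Coll (v (m - 1)) (v m) (v (m + 1)))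
    (ho : ∀ q, j ≤ q → q < p → G.Ordered (v q) (v (q + 1)) (v (q + 2))) :
    G.Ordered (v p) (v (p + 1)) y := by
  have := Ordered.disc _ _ _ (h.isDisc hG hj hp hjy hpy hm) fun i hi => ho (j + i) (by omega) (by omega)
  rwa [show j + (p - j) = p by omega, show j + (p - j + 1) = p + 1 by omega] at this

/-- In a maximal ancestral graph, all triples of a shortest m-connecting walk have an order. Shielded
triples are discriminated by a part of the walk to their left or to their right. If some triple had
no order, then there would be two of them, the first discriminated from its right by a path through
the second, and the second from its left by a path through the first. The ends of the union of the
two paths would be nonadjacent, but the union would be an inducing path. -/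
theorem IsShortestWalk.ordered (hG : G.IsMAG) (h : G.IsShortestWalk Z n v a b) (p : ℕ)
    (hp : p + 2 ≤ n) : G.Ordered (v p) (v (p + 1)) (v (p + 2)) := by
  classical
  have hA := hG.ancestral
  by_contra hbad
  have hne : ∀ i j, i ≤ n → j ≤ n → i ≠ j → v i ≠ v j := fun i j hi hj hij h' =>
    hij (h.injective hA hi hj h')
  set U : ℕ → Prop := fun p => p + 2 ≤ n ∧ ¬ G.Ordered (v p) (v (p + 1)) (v (p + 2)) with hU
  set R : ℕ → Prop := fun p => U p ∧ ∃ k ≤ n, p + 2 < k ∧ ¬ G.Adj (v k) (v p) ∧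
    (∀ m, p + 2 ≤ m → m < k →
      G.arrow (v m) (v p) ∧ G.Coll (v (m - 1)) (v m) (v (m + 1))) ∧
    ∃ q, U q ∧ p < q ∧ q + 1 < k with hR
  have hLR : ∀ p, U p → (∃ j < p, ¬ G.Adj (v j) (v (p + 2)) ∧ (∀ m, j < m → m ≤ p →
      G.arrow (v m) (v (p + 2)) ∧ G.Coll (v (m - 1)) (v m) (v (m + 1))) ∧
      ∃ q, U q ∧ j ≤ q ∧ q < p) ∨ R p := by
    rintro p ⟨hp, hno⟩
    have hadj : G.Adj (v p) (v (p + 2)) := by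
      by_contra hadj
      exact hno (Ordered.of_unshielded (hne _ _ (by omega) (by omega) (by omega))
        (h.isWalk.adj p (by omega)) (h.isWalk.adj (p + 1) (by omega)) hadj)
    rcases h.shielded hA hp hadj with ⟨j, hj, hja, hjm⟩ | ⟨k, hk, hpk, hka, hkm⟩
    · refine Or.inl ⟨j, hj, hja, hjm, ?_⟩
      by_contra hall
      refine hno (h.ordered_left hA hj (by omega) hja (h.isWalk.adj (p + 1) (by omega)) hjm
        fun q hq hqp => ?_)
      by_contra hq'
      exact hall ⟨q, ⟨by omega, hq'⟩, hq, hqp⟩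
    · refine Or.inr ⟨⟨hp, hno⟩, k, hk, hpk, hka, hkm, ?_⟩
      by_contra hall
      have := h.reverse.ordered_left hA (y := v p) (j := n - k) (p := n - (p + 2)) (by omega)
        (by omega) (by rwa [show n - (n - k) = k by omega])
        (by
          rw [show n - (n - (p + 2) + 1) = p + 1 by omega]
          exact (h.isWalk.adj p (by omega)).symm)
        (fun m hm hm' => by
          have := hkm (n - m) (by omega) (by omega)
          rw [show n - m + 1 = n - (m - 1) by omega, show n - m - 1 = n - (m + 1) by omega] at this
          exact ⟨this.1, this.2.symm⟩)
        (fun q hq hqp => by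
          by_contra hq'
          refine hall ⟨n - (q + 2), ⟨by omega, fun h' => hq' ?_⟩, by omega, by omega⟩
          rw [show n - (q + 2) + 2 = n - q by omega,
            show n - (q + 2) + 1 = n - (q + 1) by omega] at h'
          exact h'.symm)
      rw [show n - (n - (p + 2)) = p + 2 by omega,
        show n - (n - (p + 2) + 1) = p + 1 by omega] at this
      exact hno this.symm
  -- the first unordered triple is discriminated from the right
  have hRex : ∃ p, R p := by
    have hex : ∃ p, U p := ⟨p, hp, hbad⟩
    refine ⟨Nat.find hex, (hLR _ (Nat.find_spec hex)).resolve_left ?_⟩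
    rintro ⟨j, -, -, -, q, hq, -, hlt⟩
    exact Nat.find_min hex hlt hq
  obtain ⟨p, hp, hmax⟩ : ∃ p, R p ∧ ∀ q, R q → q ≤ p := by
    obtain ⟨r, hr⟩ := hRex
    have hb : ∀ q, R q → q ≤ n := fun q hq => by
      have := hq.1.1
      omega
    exact ⟨Nat.findGreatest R n, Nat.findGreatest_spec (hb r hr) hr,
      fun q hq => Nat.le_findGreatest (hb q hq) hq⟩
  obtain ⟨-, k, hk, hpk, hka, hkm, q', hq', hpq', hqk'⟩ := hp
  -- the next unordered triple after the last one of that kind is discriminated from the left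
  have hex : ∃ q, U q ∧ p < q := ⟨q', hq', hpq'⟩
  obtain ⟨q, ⟨hq, hpq⟩, hqmin⟩ : ∃ q, (U q ∧ p < q) ∧ ∀ r, U r → p < r → q ≤ r :=
    ⟨Nat.find hex, Nat.find_spec hex, fun r hr hpr => Nat.find_min' hex ⟨hr, hpr⟩⟩
  have hqk : q + 1 < k := lt_of_le_of_lt (Nat.succ_le_succ (hqmin q' hq' hpq')) hqk'
  obtain ⟨j, hj, hja, hjm, r, hr, hjr, hrq⟩ := (hLR q hq).resolve_right fun h' => by
    have := hmax q h'
    omega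
  have hjp : j ≤ p := by
    by_contra hjp
    have := hqmin r hr (by omega)
    omega
  have hqn := hq.1
  rcases Nat.eq_or_lt_of_le hjp with rfl | hjp
  · rcases Nat.eq_or_lt_of_le (show q + 2 ≤ k by omega) with rfl | hqk
    · have := hG.adj_of_inducing (n := q + 2 - j) (v := fun i => v (j + i))
        (hne _ _ (by omega) (by omega) (by omega)) (fun i hi => h.isWalk.adj (j + i) (by omega))
        (fun i hi => ?_) fun i hi => ?_
      · simp only [add_zero, show j + (q + 2 - j) = q + 2 by omega] at this
        exact hja this
      · rcases Nat.lt_or_ge (j + (i + 1)) (q + 1) with hi' | hi'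
        · exact (hjm (j + (i + 1)) (by omega) (by omega)).2
        · exact (hkm (j + (i + 1)) (by omega) (by omega)).2
      · rw [show j + (q + 2 - j) = q + 2 by omega]
        rcases Nat.lt_or_ge (j + (i + 1)) (q + 1) with hi' | hi'
        · exact Or.inr (Relation.ReflTransGen.single (hjm (j + (i + 1)) (by omega) (by omega)).1)
        · exact Or.inl (Relation.ReflTransGen.single (hkm (j + (i + 1)) (by omega) (by omega)).1)
    · exact hja (Or.inr (Or.inr (Or.inl (hkm (q + 2) (by omega) hqk).1)))
  · have harr := (hjm p hjp (by omega)).1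
    rcases Nat.eq_or_lt_of_le (show q + 2 ≤ k by omega) with rfl | hqk
    · exact hka (Or.inr (Or.inr (Or.inl harr)))
    · exact G.arrow_asymm _ _ harr (hkm (q + 2) (by omega) hqk).1

/-! ### The colliders with order determine the m-connections -/

/-- There is a directed walk of length `k` from the given vertex to `Z`. -/
inductive ReachIn (G : MixedGraph V) (Z : Set V) : ℕ → V → Prop
  | zero (u : V) (hu : u ∈ Z) : ReachIn G Z 0 u
  | succ (k : ℕ) (u w : V) (huw : G.arrow u w) (h : ReachIn G Z k w) : ReachIn G Z (k + 1) u

/-- The length of a shortest directed walk to `Z`, and the junk value `0` if there is none. -/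
noncomputable def distTo (G : MixedGraph V) (Z : Set V) (u : V) : ℕ :=
  sInf {k | G.ReachIn Z k u}

theorem AncOf.reachIn {u : V} (h : G.AncOf Z u) : G.ReachIn Z (G.distTo Z u) u := by
  obtain ⟨z, hz, huz⟩ := h
  refine Nat.sInf_mem (s := {k | G.ReachIn Z k u}) ?_
  induction huz using Relation.ReflTransGen.head_induction_on with
  | refl => exact ⟨0, ReachIn.zero z hz⟩
  | head h' _ ih => exact ih.elim fun k hk => ⟨k + 1, ReachIn.succ k _ _ h' hk⟩

theorem ReachIn.distTo_le {u : V} {k : ℕ} (h : G.ReachIn Z k u) : G.distTo Z u ≤ k :=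
  Nat.sInf_le h

theorem ReachIn.ancOf {u : V} {k : ℕ} (h : G.ReachIn Z k u) : G.AncOf Z u := by
  induction h with
  | zero u hu => exact ⟨u, hu, Relation.ReflTransGen.refl⟩
  | succ k u w huw h ih => exact ih.of_ancestor (Relation.ReflTransGen.single huw)

theorem AncOf.exists_arrow {u : V} (h : G.AncOf Z u) (hu : u ∉ Z) :
    ∃ w, G.arrow u w ∧ G.AncOf Z w ∧ G.distTo Z u = G.distTo Z w + 1 := by
  have hr := h.reachIn
  generalize hk : G.distTo Z u = k at hr
  cases hr with
  | zero _ hu' => exact absurd hu' hu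
  | succ k _ w huw hw =>
    refine ⟨w, huw, hw.ancOf, le_antisymm ?_ (Nat.succ_le_succ hw.distTo_le)⟩
    rw [← hk]
    exact (ReachIn.succ _ _ _ huw hw.ancOf.reachIn).distTo_le

/-- If `c → y` is the first edge of a shortest directed path of `G` to `Z`, and an edge of `H`, then
the whole path is directed in `H`: its triples are unshielded noncolliders. -/
theorem ancOf_of_arrow (hG : G.IsAncestral) (hH : H.IsAncestral) (hadj : G.SameAdjacencies H)
    (hcoll : ∀ a b c, G.Ordered a b c → (G.Coll a b c ↔ H.Coll a b c)) {k : ℕ} :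
    ∀ {c y : V}, G.arrow c y → H.arrow c y → G.AncOf Z y → G.distTo Z y = k →
      G.distTo Z c = k + 1 → H.AncOf Z y := by
  induction k using Nat.strong_induction_on with
  | _ k ih =>
    intro c y hcy hcy' hy hyk hck
    by_cases hyZ : y ∈ Z
    · exact ⟨y, hyZ, Relation.ReflTransGen.refl⟩
    obtain ⟨w, hyw, hw, hyw'⟩ := hy.exists_arrow hyZ
    have hcw : ¬ G.Adj c w := fun hcw => by
      have := (ReachIn.succ _ _ _ (hG.arrow_trans hcy hyw hcw) hw.reachIn).distTo_le
      omega
    have hne : c ≠ w := by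
      rintro rfl
      exact G.arrow_asymm _ _ hcy hyw
    have ho : G.Ordered c y w :=
      Ordered.of_unshielded hne (Or.inr (Or.inl hcy)) (Or.inr (Or.inl hyw)) hcw
    have hyw₂ : H.arrow y w :=
      hH.arrow_of_not_into ((hadj _ _).1 (Or.inr (Or.inl hyw))) (fun h' => not_into_of_arrow hyw
        ((hcoll _ _ _ ho).2 ⟨Or.inl hcy', h'⟩).2) (Or.inl hcy')
    exact (ih (G.distTo Z w) (by omega) hyw hyw₂ hw rfl hyw').of_ancestor
      (Relation.ReflTransGen.single hyw₂)

/-- If `c → y` leaves a collider `c` of a shortest walk, then the triple of the left neighbor, `c` and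
`y` has an order, or the walk can be joined to `y` on the left. -/
theorem IsShortestWalk.ordered_or_bypass (hG : G.IsMAG) (h : G.IsShortestWalk Z n v a b) {p : ℕ}
    (hp : p + 2 ≤ n) (hc : G.Into (v p) (v (p + 1))) (hy : G.arrow (v (p + 1)) y) :
    G.Ordered (v p) (v (p + 1)) y ∨
      ∃ j ≤ p, G.Into (v j) y ∧ (0 < j → G.Open (G.AncOf Z) Z (v (j - 1)) (v j) y) := by
  have hA := hG.ancestral
  have hcy : G.Adj (v (p + 1)) y := Or.inr (Or.inl hy)
  by_cases hadj : G.Adj (v p) y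
  · rcases h.isWalk.bypass hA (by omega) (hA.into_of_into_arrow hc hy hadj)
      (fun h' => hA.arrow_trans h' hy hadj) with h' | ⟨j, hj, hja, hjm⟩
    · exact Or.inr h'
    · exact Or.inl (h.ordered_left hA hj (by omega) hja hcy hjm fun q hq hqp =>
        h.ordered hG q (by omega))
  · refine Or.inl (Ordered.of_unshielded ?_ hc.adj hcy hadj)
    rintro rfl
    exact not_into_of_arrow hy hc

/-- Among the shortest walks, one whose vertices have the least total distance to `Z` is m-connecting
in every graph with the same adjacencies and colliders with order. -/
theorem Conn.of_sameCollidersWithOrder (hG : G.IsMAG) (hH : H.IsMAG) (hadj : G.SameAdjacencies H)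
    (hc : G.SameCollidersWithOrder H) (hconn : G.Conn Z a b) : H.Conn Z a b := by
  classical
  have hA := hG.ancestral
  have hcoll : ∀ a b c, G.Ordered a b c → (G.Coll a b c ↔ H.Coll a b c) := fun a b c ho =>
    (ordered_of_sameCollidersWithOrder hH.ancestral hadj hc ho).2
  obtain ⟨n, v₀, hv₀⟩ := hconn.exists_isShortestWalk
  have hex : ∃ s v, G.IsWalk (G.AncOf Z) Z n v a b ∧
      ∑ i ∈ Finset.range (n + 1), G.distTo Z (v i) = s := ⟨_, v₀, hv₀.isWalk, rfl⟩
  obtain ⟨v, hw, hsum⟩ := Nat.find_spec hex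
  have hmin : ∀ w, G.IsWalk (G.AncOf Z) Z n w a b →
      ∑ i ∈ Finset.range (n + 1), G.distTo Z (v i) ≤
        ∑ i ∈ Finset.range (n + 1), G.distTo Z (w i) := fun w hw' => by
    rw [hsum]
    exact Nat.find_min' hex ⟨w, hw', rfl⟩
  have h : G.IsShortestWalk Z n v a b := ⟨hw, hv₀.le⟩
  have hord := h.ordered hG
  refine ⟨n, v, hw.head, hw.last, fun i hi => (hadj _ _).1 (hw.adj i hi), fun p hp => ?_⟩
  have ho := hw.isOpen p hp
  refine ⟨fun hcH => ?_, fun hcH => ho.2 fun hcG => hcH ((hcoll _ _ _ (hord p hp)).1 hcG)⟩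
  have hcG := (hcoll _ _ _ (hord p hp)).2 hcH
  have hcZ := ho.1 hcG
  by_cases hmem : v (p + 1) ∈ Z
  · exact ⟨_, hmem, Relation.ReflTransGen.refl⟩
  obtain ⟨y, hcy, hyZ, hdist⟩ := hcZ.exists_arrow hmem
  suffices hcy' : H.arrow (v (p + 1)) y from
    (ancOf_of_arrow hA hH.ancestral hadj hcoll hcy hcy' hyZ rfl hdist).of_ancestor
      (Relation.ReflTransGen.single hcy')
  by_contra hno
  have hno' : ∀ u, H.Into u (v (p + 1)) → ¬ G.Ordered u (v (p + 1)) y := by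
    intro u hu huo
    refine hno (hH.ancestral.arrow_of_not_into ((hadj _ _).1 (Or.inr (Or.inl hcy)))
      (fun h' => ?_) hu)
    exact not_into_of_arrow hcy ((hcoll _ _ _ huo).2 ⟨hu, h'⟩).2
  -- otherwise the collider is bypassed through `y` on both sides
  obtain ⟨j, hj, hjy, hjo⟩ :=
    (h.ordered_or_bypass hG hp hcG.1 hcy).resolve_left (hno' _ hcH.1)
  obtain ⟨k, hk, hkn, hky, hko⟩ : ∃ k, p + 2 ≤ k ∧ k ≤ n ∧ G.Into (v k) y ∧
      (k < n → G.Open (G.AncOf Z) Z y (v k) (v (k + 1))) := by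
    obtain ⟨j', hj', hjy', hjo'⟩ := (h.reverse.ordered_or_bypass hG (p := n - (p + 2)) (y := y)
      (by omega)
      (by
        rw [show n - (n - (p + 2)) = p + 2 by omega, show n - (n - (p + 2) + 1) = p + 1 by omega]
        exact hcG.2)
      (by rwa [show n - (n - (p + 2) + 1) = p + 1 by omega])).resolve_left
      (by
        rw [show n - (n - (p + 2)) = p + 2 by omega, show n - (n - (p + 2) + 1) = p + 1 by omega]
        exact hno' _ hcH.2)
    refine ⟨n - j', by omega, by omega, hjy', fun hlt => ?_⟩
    rw [show n - j' + 1 = n - (j' - 1) by omega]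
    exact (hjo' (by omega)).symm
  have hyo : ∀ {i l}, G.Into (v i) y → G.Into (v l) y → G.Open (G.AncOf Z) Z (v i) y (v l) :=
    fun hi hl => ⟨fun _ => hyZ, fun h' => absurd ⟨hi, hl⟩ h'⟩
  obtain ⟨w, hw'⟩ := hw.detour (by omega) hkn hjy.adj hky.adj.symm hjo (hyo hjy hky) hko
  have hle := h.le _ _ hw'
  obtain ⟨rfl, rfl⟩ : j = p ∧ k = p + 2 := by omega
  -- the bypass replaces only the collider, by a vertex that is closer to `Z`
  have hupd : ∀ i, i ≠ j + 1 → Function.update v (j + 1) y i = v i := fun i hi =>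
    Function.update_of_ne hi _ _
  have hupd' : Function.update v (j + 1) y (j + 1) = y := Function.update_self _ _ _
  have hnew : G.IsWalk (G.AncOf Z) Z n (Function.update v (j + 1) y) a b := by
    refine ⟨by rw [hupd 0 (by omega), hw.head], by rw [hupd n (by omega), hw.last],
      fun i hi => ?_, fun i hi => ?_⟩
    · by_cases h₁ : i = j
      · subst h₁
        rw [hupd i (by omega), hupd']
        exact hjy.adj
      by_cases h₂ : i = j + 1
      · subst h₂
        rw [hupd (j + 1 + 1) (by omega), hupd']
        exact hky.adj.symm
      rw [hupd i h₂, hupd (i + 1) (by omega)]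
      exact hw.adj i hi
    · by_cases h₁ : i = j
      · subst h₁
        rw [hupd i (by omega), hupd', hupd (i + 2) (by omega)]
        exact hyo hjy hky
      by_cases h₂ : i = j + 1
      · subst h₂
        rw [hupd (j + 1 + 1) (by omega), hupd', hupd (j + 1 + 2) (by omega)]
        exact hko (by omega)
      by_cases h₃ : i + 1 = j
      · subst h₃
        rw [hupd i (by omega), hupd (i + 1) (by omega), hupd']
        exact hjo (by omega)
      rw [hupd i h₂, hupd (i + 1) (by omega), hupd (i + 2) (by omega)]
      exact hw.isOpen i hi
  refine absurd (hmin _ hnew) (not_le.2 (Finset.sum_lt_sum (fun i _ => ?_)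
    ⟨j + 1, Finset.mem_range.2 (by omega), ?_⟩))
  · by_cases hi : i = j + 1
    · subst hi
      rw [hupd']
      omega
    · rw [hupd i hi]
  · rw [hupd']
    omega

theorem IsMAG.markovEquiv_iff (hG : G.IsMAG) (hH : H.IsMAG) :
    G.MarkovEquiv H ↔ G.SameAdjacencies H ∧ G.SameCollidersWithOrder H := by
  constructor
  · intro h
    have h' : H.MarkovEquiv G := fun A B Z hA hB h₁ h₂ h₃ => (h A B Z hA hB h₁ h₂ h₃).symm
    refine ⟨hG.sameAdjacencies hH h, fun a b c => ?_⟩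
    rw [isColliderWithOrder_iff, isColliderWithOrder_iff]
    constructor
    · rintro ⟨hc, ho⟩
      have := hG.ordered_of_markovEquiv hH h ho
      exact ⟨this.2.1 hc, this.1⟩
    · rintro ⟨hc, ho⟩
      have := hH.ordered_of_markovEquiv hG h' ho
      exact ⟨this.2.1 hc, this.1⟩
  · rintro ⟨hadj, hc⟩
    refine (MixedGraph.markovEquiv_iff hG.ancestral hH.ancestral).2 fun a b Z _ _ _ => ⟨?_, ?_⟩
    · exact Conn.of_sameCollidersWithOrder hG hH hadj hc
    · exact Conn.of_sameCollidersWithOrder hH hG (fun a b => (hadj a b).symm)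
        fun a b c => (hc a b c).symm

theorem IsAncestral.existsUnique_isMAGOf (hG : G.IsAncestral) :
    ∃! M : MixedGraph V, M.IsMAGOf G :=
  ⟨G.completion hG, isMAGOf_completion hG, fun _ hM => hM.eq_completion hG⟩

end MixedGraph

theorem corollary3p28 {V : Type*} [Finite V] (G₁ G₂ : MixedGraph V)
    (h₁ : G₁.IsAncestral) (h₂ : G₂.IsAncestral) :
    (∃! M₁ : MixedGraph V, M₁.IsMAGOf G₁) ∧
    (∃! M₂ : MixedGraph V, M₂.IsMAGOf G₂) ∧
    ∀ M₁ M₂ : MixedGraph V, M₁.IsMAGOf G₁ → M₂.IsMAGOf G₂ →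
      (G₁.MarkovEquiv G₂ ↔ M₁.SameAdjacencies M₂ ∧ M₁.SameCollidersWithOrder M₂) := by
  refine ⟨h₁.existsUnique_isMAGOf, h₂.existsUnique_isMAGOf, fun M₁ M₂ hM₁ hM₂ => ?_⟩
  rw [← hM₁.isMAG.markovEquiv_iff hM₂.isMAG]
  refine forall_congr' fun A => forall_congr' fun B => forall_congr' fun Z => forall_congr' fun hA =>
    forall_congr' fun hB => forall_congr' fun hAB => forall_congr' fun hAZ =>
      forall_congr' fun hBZ => ?_
  rw [hM₁.markovEquiv A B Z hA hB hAB hAZ hBZ, hM₂.markovEquiv A B Z hA hB hAB hAZ hBZ]
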